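/- Let $\mathbb{F}$ be a field of characteristic $p>3$, let $n\ge 3$, and let $\underline{t}=(t_1,\dots,t_n)$ be a tuple of positive integers. Put $Y_0=\{1,\dots,n\}$, $Y_1=\{n+1,\dots,2n\}$, $Y=Y_0\cup Y_1$; let $\mu(i)=0$ and $i'=i+n$ for $i\in Y_0$, and $\mu(i)=1$ and $i'=i-n$ for $i\in Y_1$. Let $\mathcal{O}(n,n)=\mathcal{O}(n)\otimes\Lambda(n)$ be the tensor product of the divided power algebra $\mathcal{O}(n)$ over $\mathbb{F}$, with basis $x^{(\alpha)}$, $\alpha\in\mathbb{N}_0^n$, and multiplication $x^{(\alpha)}x^{(\beta)}=\binom{\alpha+\beta}{\alpha}x^{(\alpha+\beta)}$, and the exterior algebra $\Lambda(n)$ in the variables $x_{n+1},\dots,x_{2n}$, with basis the products $x^u$ in increasing order of the variables with index in $u\subseteq Y_1$. It is graded by $\mathbb{Z}/2$, the monomial $x^{(\alpha)}x^u$ having parity $|u|$ mod $2$, and has the superderivations $\partial_i$, $i\in Y$, with $\partial_i(x^{(\alpha)}x^u)=x^{(\alpha-\varepsilon_i)}x^u$ for $i\in Y_0$ (read as $0$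 if $\alpha_i=0$) and $\partial_i(x^{(\alpha)}x^u)=x^{(\alpha)}\,\partial x^u/\partial x_i$ for $i\in Y_1$. Let $\mathcal{O}(n,n;\underline{t})$ be the span of the $x^{(\alpha)}x^u$ with $0\le\alpha_i\le p^{t_i}-1$ for all $i\in Y_0$. Let $\mathrm{T_H}$ be the linear map with $$\mathrm{T_H}(a)=\sum_{i\in Y}(-1)^{\mu(i)\mathrm{p}(a)}\,\partial_i(a)\,\partial_{i'}$$ for homogeneous $a$ of parity $\mathrm{p}(a)$, and let $HO(n,n;\underline{t})=\{\mathrm{T_H}(a)\mid a\in\mathcal{O}(n,n;\underline{t})\}$ be the odd Hamiltonian superalgebra, a Lie superalgebra of superderivations under the supercommutator. Let $\mathcal{HO}$ be its even part, a Lie algebra under the commutator. Then the outer derivation algebra $\mathrm{Der}(\mathcal{HO})/\mathrm{ad}(\mathcal{HO})$ of $\mathcal{HO}$ is an abelian Lie algebra of finite dimension $$\dim_{\mathbb{F}}\bigl(\mathrm{Der}(\mathcal{HO})/\mathrm{ad}(\mathcal{HO})\bigr)=\sum_{i\in Y_0}t_i-n+1 .$$ -/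

import Mathlib

namespace OddHamiltonian

noncomputable section

/-- The monomials `x^(α) x^u` of `𝒪(n,n)`: an exponent `α ∈ ℕ₀ⁿ` of the divided power variables
`x_1, …, x_n` and a set `u` of indices of the exterior variables `x_{n+1}, …, x_{2n}` (the element
`k : Fin n` of `u` stands for the variable `x_{n+k}`; the factors of `x^u` are in increasing
order). -/
abbrev Mon (n : ℕ) : Type := (Fin n → ℕ) × Finset (Fin n)

/-- The superspace `𝒪(n,n) = 𝒪(n) ⊗ Λ(n)` over `F`, with basis the monomials `x^(α) x^u`. -/
abbrev O (F : Type*) [Field F] (n : ℕ) : Type _ := Mon n →₀ F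

/-- The index set `Y = Y₀ ∪ Y₁`: `Sum.inl i` is the index of the even variable `x_i`, and
`Sum.inr i` is the index `n + i` of an odd variable. The involution `i ↦ i'` is `Sum.swap`. -/
abbrev Y (n : ℕ) : Type := Fin n ⊕ Fin n

/-- The parity `μ(i)` of an index, as `0` or `1`. -/
def mu {n : ℕ} : Y n → ℕ
  | Sum.inl _ => 0
  | Sum.inr _ => 1

/-- The multi-index binomial coefficient `(α + β choose α)`. -/
def mchoose {n : ℕ} (α β : Fin n → ℕ) : ℕ := ∏ i, (α i + β i).choose (α i)

/-- The number of inversions of the concatenation of `u` and `v`, so that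
`x^u x^v = (-1)^(inv u v) x^(u ∪ v)` for disjoint `u` and `v`. -/
def inv {n : ℕ} (u v : Finset (Fin n)) : ℕ := ((u ×ˢ v).filter fun q => q.2 < q.1).card

/-- The product of two monomials. -/
def monMul (F : Type*) [Field F] {n : ℕ} (a b : Mon n) : O F n :=
  if Disjoint a.2 b.2 then
    Finsupp.single (a.1 + b.1, a.2 ∪ b.2) ((mchoose a.1 b.1 : F) * (-1) ^ inv a.2 b.2)
  else 0

/-- The multiplication of `𝒪(n,n)`, as a bilinear map. -/
def mul (F : Type*) [Field F] (n : ℕ) : O F n →ₗ[F] O F n →ₗ[F] O F n :=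
  Finsupp.linearCombination F fun a => Finsupp.linearCombination F fun b => monMul F a b

/-- The value of `∂_r` on a monomial; `x^u` with `k ∈ u` is sent by `∂/∂x_{n+k}` to
`(-1)^s x^(u \ {k})`, where `s` is the number of elements of `u` below `k`. -/
def monPartial (F : Type*) [Field F] {n : ℕ} : Y n → Mon n → O F n
  | Sum.inl i, a => if a.1 i = 0 then 0 else Finsupp.single (a.1 - Pi.single i 1, a.2) 1
  | Sum.inr k, a =>
      if k ∈ a.2 then
        Finsupp.single (a.1, a.2.erase k) ((-1) ^ (a.2.filter fun j => j < k).card)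
      else 0

/-- The superderivation `∂_r` of `𝒪(n,n)`, for `r ∈ Y`. -/
def partialD (F : Type*) [Field F] (n : ℕ) (r : Y n) : O F n →ₗ[F] O F n :=
  Finsupp.linearCombination F (monPartial F r)

/-- The `ℤ/2`-grading of `𝒪(n,n)`: the span of the monomials `x^(α) x^u` with `|u| ≡ θ`. -/
def parityPart (F : Type*) [Field F] (n : ℕ) (θ : ZMod 2) : Submodule F (O F n) :=
  Finsupp.supported F F {a : Mon n | (a.2.card : ZMod 2) = θ}

/-- The finite-dimensional subalgebra `𝒪(n,n;t)`: the span of the monomials `x^(α) x^u` with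
`α_i ≤ p^(t_i) - 1` for all `i`. -/
def truncated (F : Type*) [Field F] (p : ℕ) {n : ℕ} (t : Fin n → ℕ) : Submodule F (O F n) :=
  Finsupp.supported F F {a : Mon n | ∀ i, a.1 i < p ^ t i}

/-- The operator `f ∂_r : g ↦ f · ∂_r(g)`. -/
def vf (F : Type*) [Field F] (n : ℕ) (f : O F n) (r : Y n) : Module.End F (O F n) :=
  mul F n f ∘ₗ partialD F n r

/-- The linear map `T_H`, given on homogeneous elements by
`T_H(a) = ∑_{i ∈ Y} (-1)^(μ(i) p(a)) ∂_i(a) ∂_{i'}`; its values are in `W(n,n)`, realized as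
operators on `𝒪(n,n)`. -/
def TH (F : Type*) [Field F] (n : ℕ) : O F n →ₗ[F] Module.End F (O F n) :=
  Finsupp.linearCombination F fun a : Mon n =>
    ∑ i : Y n, (-1 : F) ^ (mu i * a.2.card) •
      vf F n (partialD F n i (Finsupp.single a 1)) i.swap

/-- The odd Hamiltonian superalgebra `HO(n,n;t) = {T_H(a) | a ∈ 𝒪(n,n;t)}`. -/
def HO (F : Type*) [Field F] (p : ℕ) {n : ℕ} (t : Fin n → ℕ) :
    Submodule F (Module.End F (O F n)) :=
  (truncated F p t).map (TH F n)

/-- The even operators on `𝒪(n,n)`: those that preserve parity. -/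
def evenEnd (F : Type*) [Field F] (n : ℕ) : Submodule F (Module.End F (O F n)) where
  carrier := {D | ∀ θ, ∀ f ∈ parityPart F n θ, D f ∈ parityPart F n θ}
  zero_mem' := fun θ _ _ => (parityPart F n θ).zero_mem
  add_mem' := fun hD hE θ f hf => (parityPart F n θ).add_mem (hD θ f hf) (hE θ f hf)
  smul_mem' := fun c _ hD θ f hf => (parityPart F n θ).smul_mem c (hD θ f hf)

variable {F : Type*} [Field F] {n : ℕ}

theorem mul_single (a b : Mon n) (x y : F) :
    mul F n (Finsupp.single a x) (Finsupp.single b y) = (x * y) • monMul F a b := by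
  simp [mul, Finsupp.linearCombination_single, smul_smul]

theorem partialD_single (r : Y n) (a : Mon n) (x : F) :
    partialD F n r (Finsupp.single a x) = x • monPartial F r a := by
  simp [partialD, Finsupp.linearCombination_single]

theorem choose_cocycle (a b c : ℕ) :
    (a + b).choose a * (a + b + c).choose (a + b) =
      (b + c).choose b * (a + (b + c)).choose a := by
  have h := Nat.choose_mul (n := a + b + c) (k := a + b) (s := a) (by omega)
  have e1 : a + b + c - a = b + c := by omega
  have e2 : a + b - a = b := by omega
  rw [e1, e2] at h
  rw [mul_comm, h, mul_comm, add_assoc]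

theorem mchoose_cocycle (α β γ : Fin n → ℕ) :
    mchoose α β * mchoose (α + β) γ = mchoose β γ * mchoose α (β + γ) := by
  simp only [mchoose, ← Finset.prod_mul_distrib, Pi.add_apply]
  exact Finset.prod_congr rfl fun i _ => choose_cocycle _ _ _

theorem mchoose_comm (α β : Fin n → ℕ) : mchoose α β = mchoose β α := by
  refine Finset.prod_congr rfl fun i _ => ?_
  rw [add_comm (β i), ← Nat.choose_symm_add]

theorem inv_union_left {u v w : Finset (Fin n)} (h : Disjoint u v) :
    inv (u ∪ v) w = inv u w + inv v w := by
  unfold inv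
  rw [Finset.union_product, Finset.filter_union, Finset.card_union_of_disjoint]
  refine Finset.disjoint_filter_filter ?_
  rw [Finset.disjoint_product]
  exact Or.inl h

theorem inv_union_right {u v w : Finset (Fin n)} (h : Disjoint v w) :
    inv u (v ∪ w) = inv u v + inv u w := by
  unfold inv
  rw [Finset.product_union, Finset.filter_union, Finset.card_union_of_disjoint]
  refine Finset.disjoint_filter_filter ?_
  rw [Finset.disjoint_product]
  exact Or.inr h

theorem inv_singleton_left (k : Fin n) (v : Finset (Fin n)) :
    inv {k} v = (v.filter fun j => j < k).card := by
  unfold inv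
  rw [Finset.singleton_product, Finset.filter_map, Finset.card_map]
  rfl

theorem inv_singleton_right (k : Fin n) (u : Finset (Fin n)) :
    inv u {k} = (u.filter fun j => k < j).card := by
  unfold inv
  rw [Finset.product_singleton, Finset.filter_map, Finset.card_map]
  rfl

theorem inv_add_inv {u v : Finset (Fin n)} (h : Disjoint u v) :
    inv u v + inv v u = u.card * v.card := by
  have e : inv v u = ((u ×ˢ v).filter fun q => ¬ q.2 < q.1).card := by
    unfold inv
    rw [← Finset.map_swap_product, Finset.filter_map, Finset.card_map]
    congr 1
    refine Finset.filter_congr fun q hq => ?_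
    have hne : q.1 ≠ q.2 := fun he =>
      Finset.disjoint_left.1 h (Finset.mem_product.1 hq).1 (he ▸ (Finset.mem_product.1 hq).2)
    simp only [Function.comp, Function.Embedding.coeFn_mk, Prod.fst_swap, Prod.snd_swap,
      not_lt]
    exact ⟨le_of_lt, fun hl => lt_of_le_of_ne hl hne⟩
  rw [e]
  unfold inv
  rw [Finset.card_filter_add_card_filter_not, Finset.card_product]

/-- The multiplication is associative. -/
theorem mul_assoc' (f g h : O F n) :
    mul F n (mul F n f g) h = mul F n f (mul F n g h) := by
  induction f using Finsupp.induction_linear with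
  | zero => simp
  | add f₁ f₂ h₁ h₂ => simp [h₁, h₂]
  | single a x =>
  induction g using Finsupp.induction_linear with
  | zero => simp
  | add f₁ f₂ h₁ h₂ => simp [h₁, h₂]
  | single b y =>
  induction h using Finsupp.induction_linear with
  | zero => simp
  | add f₁ f₂ h₁ h₂ => simp [h₁, h₂]
  | single c z =>
  obtain ⟨α, u⟩ := a
  obtain ⟨β, v⟩ := b
  obtain ⟨γ, w⟩ := c
  simp only [mul_single, monMul]
  by_cases huv : Disjoint u v
  · by_cases hvw : Disjoint v w
    · by_cases huw : Disjoint u w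
      · have h1 : Disjoint (u ∪ v) w := Finset.disjoint_union_left.2 ⟨huw, hvw⟩
        have h2 : Disjoint u (v ∪ w) := Finset.disjoint_union_right.2 ⟨huv, huw⟩
        simp only [huv, hvw, if_true, Finsupp.smul_single, smul_eq_mul, mul_single, monMul, h1, h2,
          add_assoc, Finset.union_assoc]
        congr 1
        rw [inv_union_left huv, inv_union_right hvw, pow_add, pow_add]
        have := congrArg (Nat.cast : ℕ → F) (mchoose_cocycle α β γ)
        push_cast at this
        linear_combination (x * y * z * (-1) ^ inv u v * (-1) ^ inv u w * (-1) ^ inv v w) * this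
      · have h1 : ¬ Disjoint (u ∪ v) w := fun h => huw (Finset.disjoint_union_left.1 h).1
        have h2 : ¬ Disjoint u (v ∪ w) := fun h => huw (Finset.disjoint_union_right.1 h).2
        simp only [huv, hvw, if_true, Finsupp.smul_single, smul_eq_mul, mul_single, monMul, h1, h2,
          if_false, smul_zero]
    · have h1 : ¬ Disjoint (u ∪ v) w := fun h => hvw (Finset.disjoint_union_left.1 h).2
      simp only [huv, hvw, if_true, Finsupp.smul_single, smul_eq_mul, mul_single, monMul, h1,
          if_false, smul_zero, map_zero]
  · by_cases hvw : Disjoint v w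
    · have h2 : ¬ Disjoint u (v ∪ w) := fun h => huv (Finset.disjoint_union_right.1 h).1
      simp only [huv, hvw, if_true, Finsupp.smul_single, smul_eq_mul, mul_single, monMul, h2,
          if_false, smul_zero, map_zero, LinearMap.zero_apply]
    · simp [huv, hvw]

theorem neg_one_pow_eq {j k : ℕ} (h : (j : ZMod 2) = k) : (-1 : F) ^ j = (-1) ^ k := by
  rw [ZMod.natCast_eq_natCast_iff] at h
  rw [neg_one_pow_eq_pow_mod_two, h, ← neg_one_pow_eq_pow_mod_two]

theorem parity_induction {θ : ZMod 2} {P : O F n → Prop} (h0 : P 0)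
    (hadd : ∀ f g, P f → P g → P (f + g))
    (hs : ∀ (a : Mon n) (x : F), (a.2.card : ZMod 2) = θ → P (Finsupp.single a x))
    {f : O F n} (hf : f ∈ parityPart F n θ) : P f := by
  have hf' : ∀ a ∈ f.support, (a.2.card : ZMod 2) = θ := fun a ha => hf ha
  rw [← Finsupp.sum_single f, Finsupp.sum]
  exact Finset.sum_induction _ P hadd h0 fun a ha => hs a _ (hf' a ha)

/-- The multiplication is super-commutative. -/
theorem mul_supercomm {j k : ℕ} {f g : O F n} (hf : f ∈ parityPart F n j)
    (hg : g ∈ parityPart F n k) : mul F n f g = (-1 : F) ^ (j * k) • mul F n g f := by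
  refine parity_induction (P := fun f => mul F n f g = (-1 : F) ^ (j * k) • mul F n g f)
    (by simp) (fun f₁ f₂ h₁ h₂ => by simp [h₁, h₂]) (fun a x ha => ?_) hf
  refine parity_induction (P := fun g => mul F n (Finsupp.single a x) g =
      (-1 : F) ^ (j * k) • mul F n g (Finsupp.single a x))
    (by simp) (fun f₁ f₂ h₁ h₂ => by simp [h₁, h₂]) (fun b y hb => ?_) hg
  simp only [mul_single, monMul]
  by_cases h : Disjoint a.2 b.2
  · simp only [h, h.symm, if_true, Finsupp.smul_single, smul_eq_mul, add_comm b.1,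
      Finset.union_comm b.2, mchoose_comm b.1]
    congr 1
    have e : (-1 : F) ^ (j * k) = (-1) ^ inv a.2 b.2 * (-1) ^ inv b.2 a.2 := by
      rw [← pow_add, inv_add_inv h]
      exact neg_one_pow_eq (by push_cast; rw [ha, hb])
    have e2 : (-1 : F) ^ inv b.2 a.2 * (-1) ^ inv b.2 a.2 = 1 := by
      rw [← mul_pow]; simp
    rw [e]
    linear_combination (-(x * y * (mchoose a.1 b.1 : F) * (-1) ^ inv a.2 b.2)) * e2
  · have h' : ¬ Disjoint b.2 a.2 := fun h' => h h'.symm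
    simp [h, h']

theorem single_mem_parityPart {θ : ZMod 2} {a : Mon n} (x : F) (h : (a.2.card : ZMod 2) = θ) :
    Finsupp.single a x ∈ parityPart F n θ :=
  Finsupp.single_mem_supported F x h

theorem mul_mem_parityPart {θ η : ZMod 2} {f g : O F n} (hf : f ∈ parityPart F n θ)
    (hg : g ∈ parityPart F n η) : mul F n f g ∈ parityPart F n (θ + η) := by
  refine parity_induction (P := fun f => mul F n f g ∈ parityPart F n (θ + η))
    (by simp) (fun f₁ f₂ h₁ h₂ => by simpa using add_mem h₁ h₂) (fun a x ha => ?_) hf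
  refine parity_induction (P := fun g => mul F n (Finsupp.single a x) g ∈ parityPart F n (θ + η))
    (by simp) (fun f₁ f₂ h₁ h₂ => by simpa using add_mem h₁ h₂) (fun b y hb => ?_) hg
  rw [mul_single, monMul]
  split_ifs with h
  · refine Submodule.smul_mem _ _ (single_mem_parityPart _ ?_)
    rw [Finset.card_union_of_disjoint h]
    push_cast
    rw [ha, hb]
  · simp

theorem partialD_mem_parityPart {θ : ZMod 2} {f : O F n} (r : Y n)
    (hf : f ∈ parityPart F n θ) : partialD F n r f ∈ parityPart F n (θ + mu r) := by
  refine parity_induction (P := fun f => partialD F n r f ∈ parityPart F n (θ + mu r))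
    (by simp) (fun f₁ f₂ h₁ h₂ => by simpa using add_mem h₁ h₂) (fun a x ha => ?_) hf
  rw [partialD_single]
  refine Submodule.smul_mem _ _ ?_
  cases r with
  | inl i =>
    simp only [monPartial, mu]
    split_ifs
    · simp
    · exact single_mem_parityPart _ (by simpa using ha)
  | inr k =>
    simp only [monPartial, mu]
    split_ifs with h
    · refine single_mem_parityPart _ ?_
      have h2 : a.2.card = (a.2.erase k).card + 1 := (Finset.card_erase_add_one h).symm
      rw [h2] at ha
      rw [← ha]
      have : (2 : ZMod 2) = 0 := rfl
      push_cast
      linear_combination (-1 : ZMod 2) * this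
    · simp

theorem choose_split (a b : ℕ) (h : a + b ≠ 0) :
    (a + b).choose a = (if a = 0 then 0 else (a - 1 + b).choose (a - 1)) +
      (if b = 0 then 0 else (a + (b - 1)).choose a) := by
  rcases a with _ | a
  · rcases b with _ | b
    · omega
    · simp
  · rcases b with _ | b
    · simp
    · simp only [Nat.add_eq_zero_iff, one_ne_zero, and_false, if_false, Nat.add_sub_cancel]
      rw [show a + 1 + (b + 1) = (a + b + 1) + 1 by omega, Nat.choose_succ_succ]
      have e : a + (b + 1) = a + b + 1 := by omega
      have e' : a + 1 + b = a + b + 1 := by omega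
      rw [e, e']

theorem mchoose_split (α β : Fin n → ℕ) (i : Fin n) (h : α i + β i ≠ 0) :
    mchoose α β = (if α i = 0 then 0 else mchoose (α - Pi.single i 1) β) +
      (if β i = 0 then 0 else mchoose α (β - Pi.single i 1)) := by
  have key : ∀ α β : Fin n → ℕ, mchoose α β =
      (α i + β i).choose (α i) * ∏ j ∈ Finset.univ.erase i, (α j + β j).choose (α j) :=
    fun α β => (Finset.mul_prod_erase Finset.univ (fun j => (α j + β j).choose (α j))
      (Finset.mem_univ i)).symm
  have e1 : ∏ j ∈ Finset.univ.erase i,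
      ((α - Pi.single i 1 : Fin n → ℕ) j + β j).choose ((α - Pi.single i 1 : Fin n → ℕ) j) =
      ∏ j ∈ Finset.univ.erase i, (α j + β j).choose (α j) :=
    Finset.prod_congr rfl fun j hj => by simp [Finset.ne_of_mem_erase hj]
  have e2 : ∏ j ∈ Finset.univ.erase i,
      (α j + (β - Pi.single i 1 : Fin n → ℕ) j).choose (α j) =
      ∏ j ∈ Finset.univ.erase i, (α j + β j).choose (α j) :=
    Finset.prod_congr rfl fun j hj => by simp [Finset.ne_of_mem_erase hj]
  rw [key α β, key (α - Pi.single i 1) β, key α (β - Pi.single i 1), e1, e2,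
    choose_split _ _ h]
  simp only [Pi.sub_apply, Pi.single_eq_same]
  split_ifs <;> ring

theorem leibniz_inl (i : Fin n) (a b : Mon n) :
    partialD F n (Sum.inl i) (monMul F a b) =
      mul F n (monPartial F (Sum.inl i) a) (Finsupp.single b 1) +
        mul F n (Finsupp.single a 1) (monPartial F (Sum.inl i) b) := by
  obtain ⟨α, u⟩ := a
  obtain ⟨β, v⟩ := b
  have hα : α i ≠ 0 → α - Pi.single i 1 + β = α + β - Pi.single i 1 := by
    intro h
    ext j
    by_cases hj : j = i
    · subst hj; simp; omega
    · simp [hj]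
  have hβ : β i ≠ 0 → α + (β - Pi.single i 1) = α + β - Pi.single i 1 := by
    intro h
    ext j
    by_cases hj : j = i
    · subst hj; simp; omega
    · simp [hj]
  by_cases huv : Disjoint u v
  · by_cases h0 : α i + β i = 0
    · have h1 : α i = 0 := by omega
      have h2 : β i = 0 := by omega
      simp [-Finsupp.single_mul, monMul, monPartial, partialD_single, huv, h1, h2]
    · have hs := congrArg (Nat.cast : ℕ → F) (mchoose_split α β i h0)
      push_cast at hs
      by_cases h1 : α i = 0
      · have h2 : β i ≠ 0 := by omega
        simp [-Finsupp.single_mul, monMul, monPartial, partialD_single, mul_single, huv, h1, h2, hβ h2] at hs ⊢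
        rw [hs]
      · by_cases h2 : β i = 0
        · simp [-Finsupp.single_mul, monMul, monPartial, partialD_single, mul_single, huv, h1, h2, hα h1] at hs ⊢
          rw [hs]
        · simp [-Finsupp.single_mul, monMul, monPartial, partialD_single, mul_single, huv, h1, h2, hα h1, hβ h2]
            at hs ⊢
          rw [hs, ← Finsupp.single_add]
          congr 1
          ring
  · simp only [monMul, huv, if_false, map_zero, monPartial]
    split_ifs <;> simp [mul_single, monMul, huv]

theorem leibniz_inr (k : Fin n) (a b : Mon n) :
    partialD F n (Sum.inr k) (monMul F a b) =
      mul F n (monPartial F (Sum.inr k) a) (Finsupp.single b 1) +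
        (-1 : F) ^ a.2.card • mul F n (Finsupp.single a 1) (monPartial F (Sum.inr k) b) := by
  obtain ⟨α, u⟩ := a
  obtain ⟨β, v⟩ := b
  have sq : ∀ m : ℕ, (-1 : F) ^ m * (-1) ^ m = 1 := fun m => by rw [← mul_pow]; simp
  have hcard : ∀ w : Finset (Fin n), k ∈ w →
      w.card = (w.filter fun j => j < k).card + (w.filter fun j => k < j).card + 1 := by
    intro w hw
    have e1 := Finset.card_filter_add_card_filter_not (s := w) (fun j => j < k)
    have e2 : (w.filter fun j => ¬ j < k) = insert k (w.filter fun j => k < j) := by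
      ext j
      simp only [Finset.mem_filter, Finset.mem_insert, not_lt]
      constructor
      · rintro ⟨h1, h2⟩
        rcases h2.lt_or_eq with h | h
        · exact Or.inr ⟨h1, h⟩
        · exact Or.inl h.symm
      · rintro (h | ⟨h1, h2⟩)
        · subst h; exact ⟨hw, le_rfl⟩
        · exact ⟨h1, h2.le⟩
    rw [e2, Finset.card_insert_of_notMem (by simp)] at e1
    omega
  have fe1 : ∀ w : Finset (Fin n), ((w.erase k).filter fun j => j < k) =
      w.filter fun j => j < k := by
    intro w; ext j; simp only [Finset.mem_filter, Finset.mem_erase]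
    exact ⟨fun h => ⟨h.1.2, h.2⟩, fun h => ⟨⟨h.2.ne, h.1⟩, h.2⟩⟩
  have fe2 : ∀ w : Finset (Fin n), ((w.erase k).filter fun j => k < j) =
      w.filter fun j => k < j := by
    intro w; ext j; simp only [Finset.mem_filter, Finset.mem_erase]
    exact ⟨fun h => ⟨h.1.2, h.2⟩, fun h => ⟨⟨h.2.ne', h.1⟩, h.2⟩⟩
  have sl : ∀ w z : Finset (Fin n), k ∈ w →
      inv w z = inv (w.erase k) z + (z.filter fun j => j < k).card := by
    intro w z hw
    conv_lhs => rw [← Finset.insert_erase hw, Finset.insert_eq]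
    rw [inv_union_left (by simp), inv_singleton_left, add_comm]
  have sr : ∀ w z : Finset (Fin n), k ∈ z →
      inv w z = inv w (z.erase k) + (w.filter fun j => k < j).card := by
    intro w z hw
    conv_lhs => rw [← Finset.insert_erase hw, Finset.insert_eq]
    rw [inv_union_right (by simp), inv_singleton_right, add_comm]
  by_cases hu : k ∈ u
  · by_cases hv : k ∈ v
    · have huv : ¬ Disjoint u v := fun h => Finset.disjoint_left.1 h hu hv
      have heq : Disjoint (u.erase k) v ↔ Disjoint u (v.erase k) := by
        rw [Finset.disjoint_left, Finset.disjoint_left]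
        constructor
        · intro h x hx hxv
          exact h (Finset.mem_erase.2 ⟨(Finset.mem_erase.1 hxv).1, hx⟩) (Finset.mem_erase.1 hxv).2
        · intro h x hx hxv
          exact h (Finset.mem_erase.1 hx).2 (Finset.mem_erase.2 ⟨(Finset.mem_erase.1 hx).1, hxv⟩)
      by_cases hd : Disjoint (u.erase k) v
      · have hd' := heq.1 hd
        have hun : u ∪ v.erase k = u.erase k ∪ v := by
          ext x; by_cases hx : x = k
          · subst hx; simp [hu, hv]
          · simp [hx]
        simp only [monMul, monPartial, mul_single, huv, hu, hv, hd, hd', if_true, if_false,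
          map_zero, Finsupp.smul_single, hun]
        rw [← Finsupp.single_add, eq_comm, Finsupp.single_eq_zero]
        simp only [smul_eq_mul]
        rw [sr (u.erase k) v hv, sl u (v.erase k) hu, fe1, fe2, hcard u hu]
        simp only [pow_add, pow_one]
        have s1 := sq (v.filter fun j => j < k).card
        linear_combination (-((-1 : F) ^ (u.filter fun j => j < k).card *
          (-1) ^ (u.filter fun j => k < j).card * (mchoose α β : F) *
          (-1) ^ inv (u.erase k) (v.erase k))) * s1
      · have hd' : ¬ Disjoint u (v.erase k) := fun h => hd (heq.2 h)
        simp [-Finsupp.single_mul, monMul, monPartial, mul_single, huv, hu, hv, hd, hd']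
    · have heq : Disjoint (u.erase k) v ↔ Disjoint u v := by
        rw [Finset.disjoint_left, Finset.disjoint_left]
        refine ⟨fun h x hx hxv => ?_, fun h x hx => h (Finset.mem_erase.1 hx).2⟩
        exact h (Finset.mem_erase.2 ⟨fun e => hv (e ▸ hxv), hx⟩) hxv
      by_cases huv : Disjoint u v
      · have hd := heq.2 huv
        have hun : (u ∪ v).erase k = u.erase k ∪ v := by
          rw [Finset.erase_union_distrib, Finset.erase_eq_of_notMem hv]
        have hfil : ((u ∪ v).filter fun j => j < k).card =
            (u.filter fun j => j < k).card + (v.filter fun j => j < k).card := by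
          rw [Finset.filter_union, Finset.card_union_of_disjoint
            (Finset.disjoint_filter_filter huv)]
        simp only [monMul, monPartial, partialD_single, mul_single, huv, hu, hv, hd, if_true,
          if_false, map_zero, smul_zero, add_zero, Finsupp.smul_single, hun, Finset.mem_union,
          true_or, smul_eq_mul]
        congr 1
        rw [hfil, sl u v hu]
        simp only [pow_add]
        have s1 := sq (v.filter fun j => j < k).card
        linear_combination ((-1 : F) ^ (u.filter fun j => j < k).card * (mchoose α β : F) *
          (-1) ^ inv (u.erase k) v) * s1
      · have hd : ¬ Disjoint (u.erase k) v := fun h => huv (heq.1 h)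
        simp [-Finsupp.single_mul, monMul, monPartial, mul_single, huv, hu, hv, hd]
  · by_cases hv : k ∈ v
    · have heq : Disjoint u (v.erase k) ↔ Disjoint u v := by
        rw [Finset.disjoint_left, Finset.disjoint_left]
        refine ⟨fun h x hx hxv => ?_, fun h x hx hxv => h hx (Finset.mem_erase.1 hxv).2⟩
        exact h hx (Finset.mem_erase.2 ⟨fun e => hu (e ▸ hx), hxv⟩)
      by_cases huv : Disjoint u v
      · have hd := heq.2 huv
        have hun : (u ∪ v).erase k = u ∪ v.erase k := by
          rw [Finset.erase_union_distrib, Finset.erase_eq_of_notMem hu]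
        have hfil : ((u ∪ v).filter fun j => j < k).card =
            (u.filter fun j => j < k).card + (v.filter fun j => j < k).card := by
          rw [Finset.filter_union, Finset.card_union_of_disjoint
            (Finset.disjoint_filter_filter huv)]
        have hcu : u.card = (u.filter fun j => j < k).card + (u.filter fun j => k < j).card := by
          have h1 := hcard (insert k u) (Finset.mem_insert_self k u)
          rw [Finset.card_insert_of_notMem hu, ← fe1, ← fe2, Finset.erase_insert hu] at h1
          omega
        simp only [monMul, monPartial, partialD_single, mul_single, huv, hu, hv, hd, if_true,
          if_false, map_zero, zero_add, Finsupp.smul_single, hun, Finset.mem_union,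
          or_true, smul_eq_mul, LinearMap.zero_apply]
        congr 1
        rw [hfil, sr u v hv, hcu]
        simp only [pow_add]
        ring
      · have hd : ¬ Disjoint u (v.erase k) := fun h => huv (heq.1 h)
        simp [-Finsupp.single_mul, monMul, monPartial, mul_single, huv, hu, hv, hd]
    · by_cases huv : Disjoint u v
      · simp [-Finsupp.single_mul, monMul, monPartial, partialD_single, huv, hu, hv]
      · simp [-Finsupp.single_mul, monMul, monPartial, huv, hu, hv]

/-- `∂_r` is a superderivation of parity `μ(r)`. -/
theorem partialD_mul (r : Y n) {k : ℕ} {f : O F n} (hf : f ∈ parityPart F n k) (g : O F n) :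
    partialD F n r (mul F n f g) =
      mul F n (partialD F n r f) g + (-1 : F) ^ (mu r * k) • mul F n f (partialD F n r g) := by
  refine parity_induction (P := fun f => partialD F n r (mul F n f g) =
      mul F n (partialD F n r f) g + (-1 : F) ^ (mu r * k) • mul F n f (partialD F n r g))
    (by simp) (fun f₁ f₂ h₁ h₂ => ?_) (fun a x ha => ?_) hf
  · simp only [map_add, LinearMap.add_apply, h₁, h₂, smul_add]
    abel
  induction g using Finsupp.induction_linear with
  | zero => simp
  | add f₁ f₂ h₁ h₂ =>
    simp only [map_add, h₁, h₂, smul_add]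
    abel
  | single b y =>
    have hx : (Finsupp.single a x : O F n) = x • Finsupp.single a 1 := by simp
    have hy : (Finsupp.single b y : O F n) = y • Finsupp.single b 1 := by simp
    have key : partialD F n r (monMul F a b) =
        mul F n (monPartial F r a) (Finsupp.single b 1) +
          (-1 : F) ^ (mu r * k) • mul F n (Finsupp.single a 1) (monPartial F r b) := by
      cases r with
      | inl i => simpa [mu] using leibniz_inl (F := F) i a b
      | inr i => simpa [mu, neg_one_pow_eq (F := F) ha] using leibniz_inr (F := F) i a b
    rw [mul_single, map_smul, key, partialD_single, partialD_single, hx, hy]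
    simp only [map_smul, LinearMap.smul_apply, smul_add, smul_smul]
    congr 2 <;> ring

theorem natCast_choose_eq_zero (p : ℕ) [hp : Fact p.Prime] [CharP F p] {a b t : ℕ}
    (ha : a < p ^ t) (hb : b < p ^ t) (h : p ^ t ≤ a + b) : ((a + b).choose a : F) = 0 := by
  rw [CharP.cast_eq_zero_iff F p]
  have ht : 1 ≤ t := by
    rcases t with _ | t
    · simp at ha hb h; omega
    · omega
  refine Nat.dvd_of_factorization_pos (Nat.ne_of_gt ?_)
  rw [add_comm, Nat.factorization_choose' hp.out (Nat.lt_succ_self _)]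
  refine Finset.card_pos.2 ⟨t, ?_⟩
  rw [Finset.mem_filter, Finset.mem_Ico, Nat.mod_eq_of_lt ha, Nat.mod_eq_of_lt hb]
  refine ⟨⟨ht, Nat.lt_succ_of_le ?_⟩, h⟩
  exact Nat.le_log_of_pow_le hp.out.one_lt (by omega)

theorem truncated_induction {p : ℕ} {t : Fin n → ℕ} {P : O F n → Prop} (h0 : P 0)
    (hadd : ∀ f g, P f → P g → P (f + g))
    (hs : ∀ (a : Mon n) (x : F), (∀ i, a.1 i < p ^ t i) → P (Finsupp.single a x))
    {f : O F n} (hf : f ∈ truncated F p t) : P f := by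
  have hf' : ∀ a ∈ f.support, ∀ i, a.1 i < p ^ t i := fun a ha => hf ha
  rw [← Finsupp.sum_single f, Finsupp.sum]
  exact Finset.sum_induction _ P hadd h0 fun a ha => hs a _ (hf' a ha)

theorem single_mem_truncated {p : ℕ} {t : Fin n → ℕ} {a : Mon n} (x : F)
    (h : ∀ i, a.1 i < p ^ t i) : Finsupp.single a x ∈ truncated F p t :=
  Finsupp.single_mem_supported F x h

/-- `𝒪(n,n;t)` is closed under multiplication. -/
theorem mul_mem_truncated {p : ℕ} [Fact p.Prime] [CharP F p] {t : Fin n → ℕ} {f g : O F n}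
    (hf : f ∈ truncated F p t) (hg : g ∈ truncated F p t) : mul F n f g ∈ truncated F p t := by
  refine truncated_induction (P := fun f => mul F n f g ∈ truncated F p t)
    (by simp) (fun f₁ f₂ h₁ h₂ => by simpa using add_mem h₁ h₂) (fun a x ha => ?_) hf
  refine truncated_induction (P := fun g => mul F n (Finsupp.single a x) g ∈ truncated F p t)
    (by simp) (fun f₁ f₂ h₁ h₂ => by simpa using add_mem h₁ h₂) (fun b y hb => ?_) hg
  rw [mul_single, monMul]
  split_ifs
  · refine Submodule.smul_mem _ _ ?_
    by_cases h : ∀ i, a.1 i + b.1 i < p ^ t i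
    · exact single_mem_truncated _ h
    · push Not at h
      obtain ⟨i, hi⟩ := h
      have h0 : (mchoose a.1 b.1 : F) = 0 := by
        rw [mchoose, Nat.cast_prod]
        exact Finset.prod_eq_zero (Finset.mem_univ i)
          (natCast_choose_eq_zero p (ha i) (hb i) hi)
      simp [h0]
  · simp

theorem partialD_mem_truncated {p : ℕ} {t : Fin n → ℕ} {f : O F n} (r : Y n)
    (hf : f ∈ truncated F p t) : partialD F n r f ∈ truncated F p t := by
  refine truncated_induction (P := fun f => partialD F n r f ∈ truncated F p t)
    (by simp) (fun f₁ f₂ h₁ h₂ => by simpa using add_mem h₁ h₂) (fun a x ha => ?_) hf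
  rw [partialD_single]
  refine Submodule.smul_mem _ _ ?_
  cases r with
  | inl i =>
    simp only [monPartial]
    split_ifs
    · simp
    · exact single_mem_truncated _ fun j => lt_of_le_of_lt (Nat.sub_le _ _) (ha j)
  | inr k =>
    simp only [monPartial]
    split_ifs
    · exact single_mem_truncated _ ha
    · simp

/-- The superderivations `∂_r` super-commute. -/
theorem partialD_comm (r s : Y n) (f : O F n) :
    partialD F n r (partialD F n s f) =
      (-1 : F) ^ (mu r * mu s) • partialD F n s (partialD F n r f) := by
  induction f using Finsupp.induction_linear with
  | zero => simp
  | add f₁ f₂ h₁ h₂ => simp [h₁, h₂]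
  | single a x =>
  simp only [partialD_single, map_smul]
  rw [smul_comm]
  congr 1
  obtain ⟨α, u⟩ := a
  cases r with
  | inl i =>
    cases s with
    | inl j =>
      by_cases hij : i = j
      · subst hij; simp [mu]
      · have hji : ¬ j = i := fun h => hij h.symm
        simp only [monPartial, mu, mul_zero, pow_zero, one_smul]
        by_cases hi : α i = 0 <;> by_cases hj : α j = 0 <;>
          simp [hi, hj, hij, hji, partialD_single, monPartial, tsub_right_comm]
    | inr l =>
      simp only [monPartial, mu, zero_mul, pow_zero, one_smul]
      by_cases hi : α i = 0 <;> by_cases hl : l ∈ u <;>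
        simp [hi, hl, partialD_single, monPartial]
  | inr k =>
    cases s with
    | inl j =>
      simp only [monPartial, mu, mul_zero, pow_zero, one_smul]
      by_cases hj : α j = 0 <;> by_cases hk : k ∈ u <;>
        simp [hj, hk, partialD_single, monPartial]
    | inr l =>
      have key : ∀ (w : Finset (Fin n)) (k l : Fin n), l < k → k ∈ w → l ∈ w →
          ((w.erase k).filter fun j => j < l).card = (w.filter fun j => j < l).card ∧
          (w.filter fun j => j < k).card = ((w.erase l).filter fun j => j < k).card + 1 := by
        intro w k l hlk hk hl
        constructor
        · rw [Finset.filter_erase, Finset.erase_eq_of_notMem]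
          simp [hlk.le]
        · rw [Finset.filter_erase, Finset.card_erase_add_one]
          simp [hl, hlk]
      simp only [monPartial, mu, mul_one, pow_one]
      by_cases hk : k ∈ u
      · by_cases hl : l ∈ u
        · by_cases hkl : k = l
          · subst hkl
            simp [hk, partialD_single, monPartial]
          · have hlk : ¬ l = k := fun h => hkl h.symm
            simp only [hk, hl, if_true, partialD_single, monPartial, Finset.mem_erase, ne_eq, hkl,
              hlk, not_false_eq_true, and_self, Finsupp.smul_single, smul_eq_mul,
              Finset.erase_right_comm (a := l) (b := k)]
            congr 1
            rcases lt_or_gt_of_ne hkl with h | h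
            · obtain ⟨e1, e2⟩ := key u l k h hl hk
              rw [e1, e2]; ring
            · obtain ⟨e1, e2⟩ := key u k l h hk hl
              rw [e1, e2]; ring
        · simp [hk, hl, partialD_single, monPartial]
      · simp only [hk, if_false, map_zero, smul_zero]
        split_ifs <;> simp [hk, partialD_single, monPartial]

theorem mu_swap (r : Y n) : (mu r.swap : ZMod 2) = 1 + mu r := by
  cases r with
  | inl i => simp [mu]
  | inr i => simp only [Sum.swap_inr, mu]; rfl

theorem TH_of_parity {k : ℕ} {a : O F n} (ha : a ∈ parityPart F n k) :
    TH F n a = ∑ i : Y n, (-1 : F) ^ (mu i * k) • vf F n (partialD F n i a) i.swap := by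
  refine parity_induction (P := fun a => TH F n a =
    ∑ i : Y n, (-1 : F) ^ (mu i * k) • vf F n (partialD F n i a) i.swap) ?_ ?_ ?_ ha
  · simp [vf]
  · intro f g hf hg
    rw [map_add, hf, hg, ← Finset.sum_add_distrib]
    refine Finset.sum_congr rfl fun i _ => ?_
    simp [vf, LinearMap.add_comp]
  · intro b x hb
    rw [TH, Finsupp.linearCombination_single, Finset.smul_sum]
    refine Finset.sum_congr rfl fun i _ => ?_
    have e : (-1 : F) ^ (mu i * b.2.card) = (-1) ^ (mu i * k) :=
      neg_one_pow_eq (by push_cast; rw [hb])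
    have hx : (Finsupp.single b x : O F n) = x • Finsupp.single b 1 := by simp
    rw [e, hx, map_smul, vf, vf, map_smul, LinearMap.smul_comp, smul_comm]

theorem TH_apply {k : ℕ} {a : O F n} (ha : a ∈ parityPart F n k) (h : O F n) :
    TH F n a h = ∑ i : Y n, (-1 : F) ^ (mu i * k) •
      mul F n (partialD F n i a) (partialD F n i.swap h) := by
  rw [TH_of_parity ha]
  simp [vf]

/-- `T_H` is an odd map. -/
theorem TH_mem_parityPart {k : ℕ} {a : O F n} (ha : a ∈ parityPart F n k) {θ : ZMod 2}
    {f : O F n} (hf : f ∈ parityPart F n θ) : TH F n a f ∈ parityPart F n (θ + k + 1) := by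
  rw [TH_apply ha]
  refine Submodule.sum_mem _ fun i _ => Submodule.smul_mem _ _ ?_
  have := mul_mem_parityPart (partialD_mem_parityPart i ha) (partialD_mem_parityPart i.swap hf)
  rw [mu_swap] at this
  have e : (k : ZMod 2) + mu i + (θ + (1 + mu i)) = θ + k + 1 := by
    have : (2 : ZMod 2) = 0 := rfl
    linear_combination (mu i : ZMod 2) * this
  rwa [e] at this

theorem TH_mem_truncated {p : ℕ} [Fact p.Prime] [CharP F p] {t : Fin n → ℕ} {k : ℕ} {a f : O F n}
    (hk : a ∈ parityPart F n k) (ha : a ∈ truncated F p t) (hf : f ∈ truncated F p t) :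
    TH F n a f ∈ truncated F p t := by
  rw [TH_apply hk]
  exact Submodule.sum_mem _ fun i _ => Submodule.smul_mem _ _
    (mul_mem_truncated (partialD_mem_truncated i ha) (partialD_mem_truncated i.swap hf))

theorem sign_swap (i : Y n) : (-1 : F) ^ mu i.swap = -(-1) ^ mu i := by
  cases i <;> simp [mu]

theorem sum_swap (f : Y n → O F n) : ∑ i, f i = ∑ i : Y n, f i.swap :=
  (Equiv.sum_comp (Equiv.sumComm (Fin n) (Fin n)) f).symm

theorem TH_odd_apply {a : O F n} (ha : a ∈ parityPart F n 1) (h : O F n) :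
    TH F n a h = ∑ i : Y n, (-1 : F) ^ mu i •
      mul F n (partialD F n i a) (partialD F n i.swap h) := by
  have ha' : a ∈ parityPart F n ((1 : ℕ) : ZMod 2) := by simpa using ha
  rw [TH_apply ha']
  simp

/-- For odd `a`, the operator `T_H(a)` is an even derivation. -/
theorem TH_odd_mul {a : O F n} (ha : a ∈ parityPart F n 1) (g h : O F n) :
    TH F n a (mul F n g h) = mul F n (TH F n a g) h + mul F n g (TH F n a h) := by
  induction g using Finsupp.induction_linear with
  | zero => simp
  | add f₁ f₂ h₁ h₂ =>
    simp only [map_add, LinearMap.add_apply, h₁, h₂]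
    abel
  | single b x =>
  have hb : (Finsupp.single b x : O F n) ∈ parityPart F n (b.2.card : ℕ) :=
    single_mem_parityPart x rfl
  simp only [TH_odd_apply ha, map_sum, LinearMap.sum_apply, map_smul, LinearMap.smul_apply]
  rw [← Finset.sum_add_distrib]
  refine Finset.sum_congr rfl fun i _ => ?_
  rw [← smul_add]
  congr 1
  have hi : partialD F n i a ∈ parityPart F n (mu i.swap : ℕ) := by
    rw [mu_swap]; exact partialD_mem_parityPart i ha
  rw [partialD_mul _ hb, map_add, map_smul, ← mul_assoc', ← mul_assoc', ← mul_assoc',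
    mul_supercomm hi hb, map_smul, LinearMap.smul_apply, smul_smul, ← mul_pow]
  simp

/-- The super-commutator of `∂_s` and `T_H(a)`, for odd `a`. -/
theorem partialD_TH {a : O F n} (ha : a ∈ parityPart F n 1) (s : Y n) (h : O F n) :
    partialD F n s (TH F n a h) = TH F n a (partialD F n s h) +
      ∑ i : Y n, (-1 : F) ^ mu i •
        mul F n (partialD F n s (partialD F n i a)) (partialD F n i.swap h) := by
  simp only [TH_odd_apply ha, map_sum, map_smul]
  rw [← Finset.sum_add_distrib]
  refine Finset.sum_congr rfl fun i _ => ?_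
  have hi : partialD F n i a ∈ parityPart F n (mu i.swap : ℕ) := by
    rw [mu_swap]; exact partialD_mem_parityPart i ha
  rw [partialD_mul s hi, partialD_comm s i.swap h, map_smul, smul_smul, ← pow_add, ← smul_add,
    add_comm]
  congr 2
  rw [← two_mul, pow_mul]
  simp

/-- `[T_H(a), T_H(b)] = T_H(T_H(a)(b))` for odd `a` and `b`. -/
theorem TH_comm {a b : O F n} (ha : a ∈ parityPart F n 1) (hb : b ∈ parityPart F n 1) :
    TH F n a * TH F n b - TH F n b * TH F n a = TH F n (TH F n a b) := by
  have hc : TH F n a b ∈ parityPart F n 1 := by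
    have ha' : a ∈ parityPart F n ((1 : ℕ) : ZMod 2) := by simpa using ha
    have := TH_mem_parityPart ha' hb
    have e : (1 : ZMod 2) + ((1 : ℕ) : ZMod 2) + 1 = 1 := rfl
    rwa [e] at this
  ext1 m
  ext1
  simp only [LinearMap.comp_apply, Finsupp.lsingle_apply]
  generalize (Finsupp.single m 1 : O F n) = h
  simp only [LinearMap.sub_apply, Module.End.mul_apply]
  rw [TH_odd_apply hc, TH_odd_apply hb h, TH_odd_apply hb (TH F n a h)]
  simp only [partialD_TH ha, TH_odd_mul ha, map_sum, map_smul, map_add, smul_add,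
    LinearMap.add_apply, LinearMap.sum_apply, LinearMap.smul_apply, Finset.sum_add_distrib]
  have key : (∑ x : Y n, (-1 : F) ^ mu x • ∑ y : Y n, (-1 : F) ^ mu y •
      mul F n (partialD F n x b) (mul F n (partialD F n x.swap (partialD F n y a))
        (partialD F n y.swap h))) =
      -∑ x : Y n, (-1 : F) ^ mu x • ∑ y : Y n, (-1 : F) ^ mu y •
      mul F n (mul F n (partialD F n x (partialD F n y a)) (partialD F n y.swap b))
        (partialD F n x.swap h) := by
    simp only [Finset.smul_sum, ← Finset.sum_neg_distrib]
    rw [Finset.sum_comm]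
    refine Finset.sum_congr rfl fun x _ => ?_
    rw [sum_swap]
    refine Finset.sum_congr rfl fun y _ => ?_
    rw [Sum.swap_swap, sign_swap, ← mul_assoc']
    have h1 : partialD F n y.swap b ∈ parityPart F n (mu y : ℕ) := by
      have := partialD_mem_parityPart y.swap hb
      rw [mu_swap] at this
      have e : (1 : ZMod 2) + (1 + mu y) = mu y := by
        have : (2 : ZMod 2) = 0 := rfl
        linear_combination this
      rwa [e] at this
    have h2 : partialD F n y (partialD F n x a) ∈
        parityPart F n ((1 + mu x + mu y : ℕ) : ZMod 2) := by
      have := partialD_mem_parityPart y (partialD_mem_parityPart x ha)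
      push_cast
      exact this
    rw [mul_supercomm h1 h2, partialD_comm y x a]
    simp only [map_smul, LinearMap.smul_apply, smul_smul]
    rw [← neg_smul]
    congr 1
    cases x <;> cases y <;> norm_num [mu]
  rw [key]
  abel

theorem TH_mem_evenEnd {a : O F n} (ha : a ∈ parityPart F n 1) : TH F n a ∈ evenEnd F n := by
  intro θ f hf
  have ha' : a ∈ parityPart F n ((1 : ℕ) : ZMod 2) := by simpa using ha
  have := TH_mem_parityPart ha' hf
  have e : θ + ((1 : ℕ) : ZMod 2) + 1 = θ := by
    have : (2 : ZMod 2) = 0 := rfl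
    push_cast
    linear_combination this
  rwa [e] at this

theorem eq_zero_of_mem_parityPart {θ : ZMod 2} {f : O F n} (h0 : f ∈ parityPart F n θ)
    (h1 : f ∈ parityPart F n (θ + 1)) : f = 0 := by
  ext a
  by_contra h
  have ha : a ∈ f.support := Finsupp.mem_support_iff.2 h
  have e0 : (a.2.card : ZMod 2) = θ := h0 ha
  have e1 : (a.2.card : ZMod 2) = θ + 1 := h1 ha
  rw [e0] at e1
  exact one_ne_zero (left_eq_add.1 e1)

/-- The even elements of `HO(n,n;t)` are the `T_H(a)` with `a` odd. -/
theorem mem_HO_inf_evenEnd {p : ℕ} {t : Fin n → ℕ} {D : Module.End F (O F n)} :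
    D ∈ HO F p t ⊓ evenEnd F n ↔
      ∃ a ∈ truncated F p t, a ∈ parityPart F n 1 ∧ TH F n a = D := by
  constructor
  · rintro ⟨⟨a, ha, rfl⟩, he⟩
    have hd : ∀ m : Mon n, (m.2.card : ZMod 2) ≠ 1 → (m.2.card : ZMod 2) = 0 := by
      intro m
      generalize (m.2.card : ZMod 2) = z
      revert z
      decide
    let a₁ : O F n := a.filter fun m => (m.2.card : ZMod 2) = 1
    let a₀ : O F n := a.filter fun m => ¬ (m.2.card : ZMod 2) = 1
    have hsum : a₁ + a₀ = a := Finsupp.filter_add_filter_not _ _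
    have h₁ : a₁ ∈ parityPart F n 1 := fun m hm => (Finset.mem_filter.1 hm).2
    have h₀ : a₀ ∈ parityPart F n ((0 : ℕ) : ZMod 2) := fun m hm => by
      have := hd m (Finset.mem_filter.1 hm).2
      simpa using this
    refine ⟨a₁, fun m hm => ha (Finset.mem_filter.1 hm).1, h₁, ?_⟩
    have hz : TH F n a₀ = 0 := by
      have hev : TH F n a₀ ∈ evenEnd F n := by
        intro θ f hf
        have e : TH F n a₀ f = TH F n a f - TH F n a₁ f := by
          rw [← hsum, map_add, LinearMap.add_apply, add_sub_cancel_left]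
        rw [e]
        exact Submodule.sub_mem _ (he θ f hf) (TH_mem_evenEnd h₁ θ f hf)
      ext1 m
      ext1
      simp only [LinearMap.comp_apply, Finsupp.lsingle_apply, LinearMap.zero_apply]
      have hm : (Finsupp.single m 1 : O F n) ∈ parityPart F n (m.2.card : ZMod 2) :=
        single_mem_parityPart 1 rfl
      refine eq_zero_of_mem_parityPart (hev _ _ hm) ?_
      have := TH_mem_parityPart h₀ hm
      simpa using this
    rw [← hsum, map_add, hz, add_zero]
  · rintro ⟨a, ha, h1, rfl⟩
    exact ⟨⟨a, ha, rfl⟩, TH_mem_evenEnd h1⟩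

attribute [local instance 100] LieRing.ofAssociativeRing

/-- The Lie algebra `𝓗𝓞`, the even part of `HO(n,n;t)`, with the commutator of operators as
bracket. -/
def evenHO (F : Type*) [Field F] (p : ℕ) [Fact p.Prime] [CharP F p] {n : ℕ} (t : Fin n → ℕ) :
    LieSubalgebra F (Module.End F (O F n)) :=
  { HO F p t ⊓ evenEnd F n with
    lie_mem' := by
      intro D E hD hE
      change D ∈ HO F p t ⊓ evenEnd F n at hD
      change E ∈ HO F p t ⊓ evenEnd F n at hE
      change ⁅D, E⁆ ∈ HO F p t ⊓ evenEnd F n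
      obtain ⟨a, hat, ha, rfl⟩ := mem_HO_inf_evenEnd.1 hD
      obtain ⟨b, hbt, hb, rfl⟩ := mem_HO_inf_evenEnd.1 hE
      have ha' : a ∈ parityPart F n ((1 : ℕ) : ZMod 2) := by simpa using ha
      exact mem_HO_inf_evenEnd.2 ⟨TH F n a b, TH_mem_truncated ha' hat hbt,
        TH_mem_evenEnd ha 1 b hb, (TH_comm ha hb).symm⟩ }

/-- The outer derivation algebra `Der(L) / ad(L)` of a Lie algebra `L`. -/
abbrev OuterDer (R L : Type*) [CommRing R] [LieRing L] [LieAlgebra R L] : Type _ :=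
  LieDerivation R L L ⧸ (LieDerivation.ad R L).idealRange

end

end OddHamiltonian

namespace OddHamiltonian

noncomputable section

variable {F : Type*} [Field F] {n : ℕ}

/-! Write ξ_i for the exterior variable x_{n+i}. An odd element `a` is determined by T_H(a)
(`TH_eq_zero_iff`), and [T_H(a), T_H(b)] = T_H(T_H(a)(b)). So 𝓗𝓞 is the odd part of 𝒪(n,n;t) with
the bracket {a, b} = T_H(a)(b). In it ξ_i acts as -∂_i, and the commuting elements x_i ξ_i act
diagonally: x^(α) ξ^u has i-th weight [i ∈ u] - α_i, taken mod p.

Every derivation D becomes zero on all ξ_i and x_i ξ_i after subtraction of an inner one. The values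
D(ξ_i) satisfy the closedness relations of a gradient and have a primitive in the truncated algebra
(`exists_ad_eq_on_xi`); the values on the torus are then absorbed by an element free of x
(`exists_ad_eq_on_torus`).

A derivation normalized in this way preserves weights and commutes with every ∂_i. If it kills all
derivatives of a monomial, its value there is free of x, and monomials free of x have only the
weights 0 and 1. This rigidity, together with brackets that produce a monomial from ones already
killed, leaves few parameters: the coefficient of ξ_i in D(x_i^(p^v) ξ_i) for 1 ≤ v < t_i, and the
coefficient of ξ^s in D(ξ^s) for one fixed s with three elements (`Normalized.eq_zero`).

All parameters occur: ∂_i^(p^v) and the multiplication by |u| - 1 are normalized derivations dual to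
them (`outerCoordinate_outerDerivation`). They commute, and only zero is both inner and normalized
(`eq_zero_of_ad_normalized`), so their classes are a basis of an abelian quotient, with ∑ (t_i - 1)
+ 1 elements. -/

/-! ### Coefficients of partial derivatives, and brackets of special monomials -/

theorem partialD_inl_apply (i : Fin n) (f : O F n) (a : Mon n) :
    partialD F n (Sum.inl i) f a = f (a.1 + Pi.single i 1, a.2) := by
  induction f using Finsupp.induction_linear with
  | zero => simp
  | add f g hf hg => simp [hf, hg]
  | single b x =>
    obtain ⟨α, u⟩ := a
    obtain ⟨β, v⟩ := b
    rw [partialD_single, monPartial]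
    by_cases h : β i = 0
    · have : ¬ (β = α + Pi.single i 1) := fun e => by simp [e] at h
      simp [h, this]
    · have : β - Pi.single i 1 = α ↔ β = α + Pi.single i 1 := by
        constructor
        · rintro rfl
          ext j
          by_cases hj : j = i
          · subst hj; simp; omega
          · simp [hj]
        · rintro rfl
          simp
      simp [h, Finsupp.single_apply, this]

theorem partialD_inr_apply (k : Fin n) (f : O F n) (a : Mon n) :
    partialD F n (Sum.inr k) f a =
      if k ∈ a.2 then 0 else
        (-1) ^ (a.2.filter fun j => j < k).card * f (a.1, insert k a.2) := by
  induction f using Finsupp.induction_linear with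
  | zero => simp
  | add f g hf hg =>
    simp only [map_add, Finsupp.add_apply, hf, hg]
    split_ifs <;> ring
  | single b x =>
    obtain ⟨α, u⟩ := a
    obtain ⟨β, v⟩ := b
    rw [partialD_single, monPartial]
    by_cases hv : k ∈ v
    · by_cases hu : k ∈ u
      · have : v.erase k ≠ u := by rintro rfl; simp at hu
        simp [hv, hu, this]
      · have : v.erase k = u ↔ v = insert k u := by
          constructor
          · rintro rfl; rw [Finset.insert_erase hv]
          · rintro rfl; rw [Finset.erase_insert hu]
        simp only [hv, hu, if_true, if_false, Finsupp.smul_single, Finsupp.single_apply,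
          Prod.mk.injEq, this]
        split_ifs with h
        · obtain ⟨rfl, rfl⟩ := h
          simp [Finset.filter_insert, mul_comm]
        · simp
    · have : v ≠ insert k u := by rintro rfl; simp at hv
      simp [hv, this]

/-- Grouping i with i' yields the classical odd Poisson bracket, in which oddness of `a` removes
every other sign. -/
theorem TH_odd_eq_sum {a : O F n} (ha : a ∈ parityPart F n 1) (h : O F n) :
    TH F n a h = ∑ k : Fin n,
      (mul F n (partialD F n (Sum.inl k) a) (partialD F n (Sum.inr k) h) -
        mul F n (partialD F n (Sum.inr k) a) (partialD F n (Sum.inl k) h)) := by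
  rw [TH_odd_apply ha, Fintype.sum_sum_type, Finset.sum_sub_distrib, sub_eq_add_neg,
    ← Finset.sum_neg_distrib]
  simp [mu]

theorem mchoose_zero_left (β : Fin n → ℕ) : mchoose 0 β = 1 := by simp [mchoose]

theorem mchoose_zero_right (β : Fin n → ℕ) : mchoose β 0 = 1 := by simp [mchoose]

theorem mul_single_zero_left (f : O F n) :
    mul F n (Finsupp.single (0, ∅) 1) f = f := by
  induction f using Finsupp.induction_linear with
  | zero => simp
  | add f g hf hg => simp [hf, hg]
  | single b x => simp [-Finsupp.single_mul, mul_single, monMul, mchoose_zero_left, inv]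

theorem single_odd (a : Mon n) (x : F) (h : Odd a.2.card) :
    (Finsupp.single a x : O F n) ∈ parityPart F n 1 :=
  single_mem_parityPart x ((ZMod.natCast_eq_one_iff_odd).2 h)

/-- The bracket with an odd coordinate is a partial derivative. -/
theorem TH_odd_coordinate (i : Fin n) (f : O F n) :
    TH F n (Finsupp.single (0, {i}) 1) f = -partialD F n (Sum.inl i) f := by
  rw [TH_odd_eq_sum (single_odd _ _ (by simp)), Finset.sum_eq_single i]
  · simp [-Finsupp.single_mul, partialD_single, monPartial, mul_single_zero_left,
      Finset.filter_singleton]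
  · intro k _ hk
    simp [partialD_single, monPartial, hk]
  · simp

/-- The weight of a monomial with respect to `x_i x_{i'}`. -/
def weight (F : Type*) [Field F] {n : ℕ} (a : Mon n) (i : Fin n) : F :=
  (if i ∈ a.2 then 1 else 0) - (a.1 i : F)

/-- The bracket with x_i ξ_i is ξ_i ∂/∂ξ_i - x_i ∂_i. The first term counts ξ_i; the second has
eigenvalue α_i because x_i x_i^(α_i - 1) = α_i x_i^(α_i) for divided powers. -/
theorem TH_torus_single (i : Fin n) (a : Mon n) :
    TH F n (Finsupp.single (Pi.single i 1, {i}) 1) (Finsupp.single a 1) =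
      weight F a i • Finsupp.single a 1 := by
  obtain ⟨α, u⟩ := a
  rw [TH_odd_eq_sum (single_odd _ _ (by simp)), Finset.sum_eq_single i]
  · rw [weight, sub_smul]
    congr 1
    · by_cases hu : i ∈ u
      · simp only [partialD_single, monPartial, Pi.single_eq_same, one_ne_zero, if_false, tsub_self,
          one_smul, hu, if_true, mul_single, monMul, one_mul, Finset.disjoint_singleton_left,
          Finset.notMem_erase, not_false_eq_true, mchoose_zero_left, Nat.cast_one, zero_add,
          inv_singleton_left, Finsupp.smul_single, smul_eq_mul]
        congr 1
        · rw [← Finset.insert_eq, Finset.insert_erase hu]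
        · rw [Finset.filter_erase, Finset.erase_eq_of_notMem (by simp), ← mul_pow]
          simp
      · simp [partialD_single, monPartial, hu]
    · by_cases hα : α i = 0
      · simp [partialD_single, monPartial, hα]
      · have h1 : Pi.single i 1 + (α - Pi.single i 1) = α := by
          ext j
          by_cases hj : j = i
          · subst hj; simp; omega
          · simp [hj]
        have h2 : mchoose (Pi.single i 1) (α - Pi.single i 1) = α i := by
          rw [mchoose, Finset.prod_eq_single i]
          · simp; omega
          · intro j _ hj; simp [hj]
          · simp
        simp [-Finsupp.single_mul, partialD_single, monPartial, hα, mul_single, monMul, h1, h2,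
          inv, Finset.filter_singleton]
  · intro k _ hk
    simp [partialD_single, monPartial, hk]
  · simp

theorem TH_torus_apply (i : Fin n) (f : O F n) (a : Mon n) :
    TH F n (Finsupp.single (Pi.single i 1, {i}) 1) f a = weight F a i * f a := by
  induction f using Finsupp.induction_linear with
  | zero => simp
  | add f g hf hg => simp [hf, hg, mul_add]
  | single b x =>
    have hx : (Finsupp.single b x : O F n) = x • Finsupp.single b 1 := by simp
    rw [hx, map_smul, TH_torus_single]
    by_cases h : b = a
    · subst h; simp [mul_comm]
    · simp [h]

/-- The bracket `{x_i^(m) ξ_i, x^(γ) ξ_k}` for `k ≠ i`. -/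
theorem TH_power_vector {i k : Fin n} (hik : k ≠ i) (m : ℕ) (γ : Fin n → ℕ) (hγ : γ i ≠ 0) :
    TH F n (Finsupp.single (Pi.single i m, {i}) 1) (Finsupp.single (γ, {k}) 1) =
      -((m + γ i - 1).choose m : F) •
        Finsupp.single (Pi.single i m + (γ - Pi.single i 1), {k}) 1 := by
  rw [TH_odd_eq_sum (single_odd _ _ (by simp)), Finset.sum_eq_single i]
  · have h2 : mchoose (Pi.single i m) (γ - Pi.single i 1) = (m + γ i - 1).choose m := by
      rw [mchoose, Finset.prod_eq_single i]
      · simp only [Pi.single_eq_same, Pi.sub_apply]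
        congr 1; omega
      · intro j _ hj; simp [hj]
      · simp
    simp [-Finsupp.single_mul, partialD_single, monPartial, hγ, mul_single, monMul, h2,
      inv, Finset.filter_singleton, hik.symm]
  · intro j _ hj
    simp only [partialD_single, monPartial]
    simp [hj]
  · simp

/-- Up to sign, `{x_i ξ_j, ξ^s} = ξ^(s \ {i} ∪ {j})`. -/
theorem TH_exchange {i j : Fin n} {s : Finset (Fin n)} (hi : i ∈ s) (hj : j ∉ s) :
    ∃ c : F, c ≠ 0 ∧
      TH F n (Finsupp.single (Pi.single i 1, {j}) 1) (Finsupp.single (0, s) 1) =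
        c • Finsupp.single (0, insert j (s.erase i)) 1 := by
  refine ⟨(-1) ^ (s.filter fun l => l < i).card * (-1) ^ inv {j} (s.erase i),
    by simp, ?_⟩
  have hd : j ∉ s.erase i := fun h => hj (Finset.mem_erase.1 h).2
  rw [TH_odd_eq_sum (single_odd _ _ (by simp)), Finset.sum_eq_single i]
  · simp [-Finsupp.single_mul, partialD_single, monPartial, hi, mul_single, monMul, hd,
      mchoose_zero_left]
  · intro l _ hl
    simp [partialD_single, monPartial, hl]
  · simp

/-- Up to sign, `{x^(α) x_k ξ^v, ξ_k ξ_a ξ_b} = x^(α) ξ^(v ∪ {a, b})` for `k ∈ v`. -/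
theorem TH_trivector {k a b : Fin n} {α : Fin n → ℕ} {v : Finset (Fin n)} (hv : Odd v.card)
    (hk : k ∈ v) (ha : a ∉ v) (hb : b ∉ v) (hab : a ≠ b) :
    ∃ c : F, c ≠ 0 ∧
      TH F n (Finsupp.single (α + Pi.single k 1, v) 1) (Finsupp.single (0, {k, a, b}) 1) =
        c • Finsupp.single (α, v ∪ {a, b}) 1 := by
  have hka : k ≠ a := fun h => ha (h ▸ hk)
  have hkb : k ≠ b := fun h => hb (h ▸ hk)
  have he : ({k, a, b} : Finset (Fin n)).erase k = {a, b} := by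
    rw [Finset.erase_insert]; simp [hka, hkb]
  refine ⟨(-1) ^ (({k, a, b} : Finset (Fin n)).filter fun l => l < k).card *
    (-1) ^ inv v {a, b}, by simp, ?_⟩
  rw [TH_odd_eq_sum (single_odd _ _ hv), Finset.sum_eq_single k]
  · have hd : Disjoint v {a, b} := by
      rw [Finset.disjoint_right]; intro x hx
      rcases Finset.mem_insert.1 hx with rfl | hx
      · exact ha
      · rw [Finset.mem_singleton.1 hx]; exact hb
    simp only [partialD_single, monPartial, he, Pi.add_apply, Pi.single_eq_same,
      Nat.add_eq_zero_iff, one_ne_zero, and_false, if_false, Finset.mem_insert_self, if_true,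
      add_tsub_cancel_right, Pi.zero_apply, smul_zero, map_zero, sub_zero, one_smul]
    simp [-Finsupp.single_mul, mul_single, monMul, hd, mchoose_zero_right]
  · intro l _ hl
    simp only [partialD_single, monPartial, Pi.zero_apply, if_true, smul_zero, map_zero, sub_zero,
      one_smul]
    by_cases hl' : l ∈ ({k, a, b} : Finset (Fin n))
    · have hd : ¬ Disjoint v (({k, a, b} : Finset (Fin n)).erase l) := by
        rw [Finset.not_disjoint_iff]
        exact ⟨k, hk, Finset.mem_erase.2 ⟨hl.symm, Finset.mem_insert_self _ _⟩⟩
      rw [if_pos hl']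
      split_ifs
      · simp
      · simp [-Finsupp.single_mul, mul_single, monMul, hd]
    · rw [if_neg hl']; simp
  · simp

/-! ### The exterior degree -/

/-- The operator multiplying a monomial by the number of its exterior variables. -/
def extDegree (F : Type*) [Field F] (n : ℕ) : O F n →ₗ[F] O F n :=
  Finsupp.linearCombination F fun a => Finsupp.single a (a.2.card : F)

theorem extDegree_single (a : Mon n) (x : F) :
    extDegree F n (Finsupp.single a x) = (a.2.card : F) • Finsupp.single a x := by
  simp [extDegree, Finsupp.linearCombination_single, mul_comm]

theorem extDegree_apply (f : O F n) (a : Mon n) : extDegree F n f a = (a.2.card : F) * f a := by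
  induction f using Finsupp.induction_linear with
  | zero => simp
  | add f g hf hg => simp [hf, hg, mul_add]
  | single b x =>
    rw [extDegree_single]
    by_cases h : b = a
    · subst h; simp
    · simp [h]

theorem extDegree_mul (f g : O F n) :
    extDegree F n (mul F n f g) = mul F n (extDegree F n f) g + mul F n f (extDegree F n g) := by
  induction f using Finsupp.induction_linear with
  | zero => simp
  | add f₁ f₂ h₁ h₂ => simp only [map_add, LinearMap.add_apply, h₁, h₂]; abel
  | single a x =>
  induction g using Finsupp.induction_linear with
  | zero => simp
  | add f₁ f₂ h₁ h₂ => simp only [map_add, h₁, h₂]; abel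
  | single b y =>
    simp only [extDegree_single, map_smul, LinearMap.smul_apply, mul_single, monMul]
    rw [← add_smul]
    split_ifs with h
    · rw [extDegree_single, Finset.card_union_of_disjoint h]
      simp only [smul_smul]
      congr 1
      push_cast
      ring
    · simp

theorem extDegree_partialD_inl (i : Fin n) (f : O F n) :
    extDegree F n (partialD F n (Sum.inl i) f) = partialD F n (Sum.inl i) (extDegree F n f) := by
  ext a
  simp [extDegree_apply, partialD_inl_apply]

theorem extDegree_partialD_inr (i : Fin n) (f : O F n) :
    extDegree F n (partialD F n (Sum.inr i) f) =
      partialD F n (Sum.inr i) (extDegree F n f) - partialD F n (Sum.inr i) f := by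
  ext a
  simp only [extDegree_apply, partialD_inr_apply, Finsupp.sub_apply]
  split_ifs with h
  · simp
  · rw [Finset.card_insert_of_notMem h]
    push_cast
    ring

theorem extDegree_mem_parityPart {θ : ZMod 2} {f : O F n} (hf : f ∈ parityPart F n θ) :
    extDegree F n f ∈ parityPart F n θ := by
  intro a ha
  refine hf (Finsupp.mem_support_iff.2 fun h => ?_)
  simp [extDegree_apply, h] at ha

theorem extDegree_mem_truncated {p : ℕ} {t : Fin n → ℕ} {f : O F n} (hf : f ∈ truncated F p t) :
    extDegree F n f ∈ truncated F p t := by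
  intro a ha
  refine hf (Finsupp.mem_support_iff.2 fun h => ?_)
  simp [extDegree_apply, h] at ha

/-- Each summand of the bracket removes exactly one exterior variable, so the bracket has exterior
degree -1. The correction term is why |u| - 1, and not |u|, is a derivation of 𝓗𝓞. -/
theorem extDegree_TH {a b : O F n} (ha : a ∈ parityPart F n 1) :
    extDegree F n (TH F n a b) =
      TH F n (extDegree F n a) b + TH F n a (extDegree F n b) - TH F n a b := by
  rw [TH_odd_eq_sum ha, TH_odd_eq_sum ha, TH_odd_eq_sum (extDegree_mem_parityPart ha), map_sum,
    ← Finset.sum_add_distrib, ← Finset.sum_sub_distrib]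
  refine Finset.sum_congr rfl fun k _ => ?_
  simp only [map_sub, extDegree_mul, extDegree_partialD_inl, extDegree_partialD_inr,
    LinearMap.sub_apply]
  abel

/-! ### 𝓗𝓞 as the odd part of 𝒪(n,n;t) -/

/-- An odd element is determined by its image under `T_H`. -/
theorem TH_eq_zero_iff {a : O F n} (ha : a ∈ parityPart F n 1) : TH F n a = 0 ↔ a = 0 := by
  refine ⟨fun h => ?_, fun h => by rw [h, map_zero]⟩
  ext ⟨α, u⟩
  by_contra h0
  have hu : (u.card : ZMod 2) = 1 := ha (Finsupp.mem_support_iff.2 h0)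
  obtain ⟨k, hk⟩ : u.Nonempty := by
    rw [Finset.nonempty_iff_ne_empty]; rintro rfl; simp at hu
  -- Evaluation at x_k leaves only -∂a/∂ξ_k, and since k ∈ u this derivative retains the coefficient
  -- of x^(α) ξ^u up to sign.
  have h1 := congrArg (fun T => T (Finsupp.single (Pi.single k 1, ∅) 1)) h
  simp only [LinearMap.zero_apply] at h1
  rw [TH_odd_eq_sum ha, Finset.sum_eq_single k] at h1
  · have h2 : (Finsupp.single (0, ∅) 1 : O F n) ∈ parityPart F n ((0 : ℕ) : ZMod 2) :=
      single_mem_parityPart _ (by simp)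
    have h3 : partialD F n (Sum.inr k) a ∈ parityPart F n ((0 : ℕ) : ZMod 2) := by
      have := partialD_mem_parityPart (Sum.inr k) ha
      have e : (1 : ZMod 2) + (mu (Sum.inr k : Y n) : ZMod 2) = ((0 : ℕ) : ZMod 2) := by
        simp only [mu]; rfl
      rwa [e] at this
    simp only [partialD_single, monPartial, Finset.notMem_empty, if_false, smul_zero, map_zero,
      Pi.single_eq_same, one_ne_zero, tsub_self, one_smul, zero_sub, neg_eq_zero] at h1
    rw [mul_supercomm h3 h2, mul_single_zero_left] at h1
    have h4 := DFunLike.congr_fun h1 (α, u.erase k)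
    simp [partialD_inr_apply, Finset.insert_erase hk] at h4
    exact h0 h4
  · intro l _ hl
    simp [partialD_single, monPartial, hl]
  · simp

attribute [local instance 100] LieRing.ofAssociativeRing

section

/-- The monomials that index the basis of `𝓗𝓞`. -/
def Admissible (p : ℕ) (t : Fin n → ℕ) (a : Mon n) : Prop :=
  (∀ i, a.1 i < p ^ t i) ∧ Odd a.2.card

/-- The odd part of `𝒪(n,n;t)`. -/
def oddPart (F : Type*) [Field F] (p : ℕ) (t : Fin n → ℕ) : Submodule F (O F n) :=
  Finsupp.supported F F {a | Admissible p t a}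

theorem mem_oddPart {p : ℕ} {t : Fin n → ℕ} {f : O F n} :
    f ∈ oddPart F p t ↔ f ∈ truncated F p t ∧ f ∈ parityPart F n 1 := by
  simp only [oddPart, truncated, parityPart, Finsupp.mem_supported, Set.subset_def, Admissible,
    Set.mem_ofPred_eq, ZMod.natCast_eq_one_iff_odd]
  exact ⟨fun h => ⟨fun x hx => (h x hx).1, fun x hx => (h x hx).2⟩,
    fun h x hx => ⟨h.1 x hx, h.2 x hx⟩⟩

theorem extDegree_mem_oddPart {p : ℕ} {t : Fin n → ℕ} {f : O F n} (hf : f ∈ oddPart F p t) :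
    extDegree F n f ∈ oddPart F p t :=
  mem_oddPart.2 ⟨extDegree_mem_truncated (mem_oddPart.1 hf).1,
    extDegree_mem_parityPart (mem_oddPart.1 hf).2⟩

variable (F) in
/-- The isomorphism `T_H` from the odd part of `𝒪(n,n;t)` to `𝓗𝓞`. -/
def oddPartEquiv (p : ℕ) [Fact p.Prime] [CharP F p] (t : Fin n → ℕ) :
    oddPart F p t ≃ₗ[F] evenHO F p t :=
  LinearEquiv.ofBijective
    (LinearMap.codRestrict (evenHO F p t).toSubmodule (TH F n ∘ₗ (oddPart F p t).subtype)
      fun f => mem_HO_inf_evenEnd.2 ⟨f, (mem_oddPart.1 f.2).1, (mem_oddPart.1 f.2).2, rfl⟩) <| by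
    constructor
    · intro f g hfg
      have h : TH F n f.1 = TH F n g.1 := congrArg Subtype.val hfg
      have h0 : TH F n (f.1 - g.1) = 0 := by rw [map_sub, h, sub_self]
      rw [TH_eq_zero_iff (Submodule.sub_mem _ (mem_oddPart.1 f.2).2 (mem_oddPart.1 g.2).2)] at h0
      exact Subtype.ext (sub_eq_zero.1 h0)
    · rintro ⟨D, hD⟩
      obtain ⟨a, h1, h2, h3⟩ := mem_HO_inf_evenEnd.1 hD
      exact ⟨⟨a, mem_oddPart.2 ⟨h1, h2⟩⟩, Subtype.ext h3⟩

variable {p : ℕ} [Fact p.Prime] [CharP F p] {t : Fin n → ℕ}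

theorem coe_oddPartEquiv (f : oddPart F p t) : (oddPartEquiv F p t f : Module.End F (O F n)) =
    TH F n f := rfl

/-- The odd element `a` of `𝒪(n,n;t)` with `T_H(a)` equal to the given element of `𝓗𝓞`. -/
def symbol (x : evenHO F p t) : O F n := (oddPartEquiv F p t).symm x

theorem symbol_mem (x : evenHO F p t) : symbol x ∈ oddPart F p t :=
  ((oddPartEquiv F p t).symm x).2

theorem symbol_injective : Function.Injective (symbol : evenHO F p t → O F n) :=
  Subtype.val_injective.comp (oddPartEquiv F p t).symm.injective

@[simp] theorem symbol_zero : symbol (0 : evenHO F p t) = 0 := by simp [symbol]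
@[simp] theorem symbol_add (x y : evenHO F p t) : symbol (x + y) = symbol x + symbol y := by
  simp [symbol]
@[simp] theorem symbol_sub (x y : evenHO F p t) : symbol (x - y) = symbol x - symbol y := by
  simp [symbol]
@[simp] theorem symbol_neg (x : evenHO F p t) : symbol (-x) = -symbol x := by
  simp [symbol]
@[simp] theorem symbol_smul (c : F) (x : evenHO F p t) : symbol (c • x) = c • symbol x := by
  simp [symbol]

theorem symbol_oddPartEquiv (f : oddPart F p t) : symbol (oddPartEquiv F p t f) = f := by
  simp [symbol]

theorem coe_eq_TH_symbol (x : evenHO F p t) : (x : Module.End F (O F n)) = TH F n (symbol x) := by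
  rw [symbol, ← coe_oddPartEquiv, LinearEquiv.apply_symm_apply]

theorem symbol_odd (x : evenHO F p t) : symbol x ∈ parityPart F n 1 :=
  (mem_oddPart.1 (symbol_mem x)).2

/-- Injectivity of T_H on odd elements turns `TH_comm` into a formula for the bracket of symbols;
all later computations take place there. -/
theorem symbol_lie (x y : evenHO F p t) : symbol ⁅x, y⁆ = TH F n (symbol x) (symbol y) := by
  have h2 : TH F n (symbol x) (symbol y) ∈ oddPart F p t := by
    refine mem_oddPart.2 ⟨?_, TH_mem_evenEnd (symbol_odd x) 1 _ (symbol_odd y)⟩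
    have : symbol x ∈ parityPart F n ((1 : ℕ) : ZMod 2) := by simpa using symbol_odd x
    exact TH_mem_truncated this (mem_oddPart.1 (symbol_mem x)).1 (mem_oddPart.1 (symbol_mem y)).1
  have : ⁅x, y⁆ = oddPartEquiv F p t ⟨_, h2⟩ := by
    apply Subtype.ext
    rw [LieSubalgebra.coe_bracket, LieRing.of_associative_ring_bracket, coe_oddPartEquiv,
      coe_eq_TH_symbol x, coe_eq_TH_symbol y, TH_comm (symbol_odd x) (symbol_odd y)]
  rw [this, symbol_oddPartEquiv]

theorem symbol_apply_of_not_admissible (x : evenHO F p t) {a : Mon n} (h : ¬ Admissible p t a) :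
    symbol x a = 0 := by
  by_contra h0
  exact h (symbol_mem x (Finsupp.mem_support_iff.2 h0))

theorem symbol_ext {x y : evenHO F p t} (h : ∀ a, Admissible p t a → symbol x a = symbol y a) :
    x = y := by
  refine symbol_injective (Finsupp.ext fun a => ?_)
  by_cases ha : Admissible p t a
  · exact h a ha
  · rw [symbol_apply_of_not_admissible x ha, symbol_apply_of_not_admissible y ha]

theorem finite_admissible (p : ℕ) (t : Fin n → ℕ) : {a : Mon n | Admissible p t a}.Finite := by
  refine ((Set.Finite.pi' fun i => Set.finite_lt_nat (p ^ t i)).prod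
    (Set.toFinite (Set.univ : Set (Finset (Fin n))))).subset ?_
  intro a ha
  exact ⟨fun i => ha.1 i, trivial⟩

theorem exists_symbol_apply (f : Mon n → F) (hf : ∀ a, ¬ Admissible p t a → f a = 0) :
    ∃ x : evenHO F p t, ∀ a, symbol x a = f a := by
  have hfin : (Function.support f).Finite :=
    (finite_admissible p t).subset fun a ha => by_contra fun h => ha (hf a h)
  refine ⟨oddPartEquiv F p t ⟨Finsupp.ofSupportFinite f hfin, fun a ha => ?_⟩, fun a => ?_⟩
  · by_contra h
    exact Finsupp.mem_support_iff.1 ha (hf a h)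
  · rw [symbol_oddPartEquiv]; rfl

variable (F p t) in
open Classical in
/-- The basis element of `𝓗𝓞` of an admissible monomial (and zero for the other monomials). -/
def mono (a : Mon n) : evenHO F p t :=
  if h : Admissible p t a then oddPartEquiv F p t ⟨Finsupp.single a 1,
    Finsupp.single_mem_supported F 1 h⟩ else 0

theorem symbol_mono {a : Mon n} (h : Admissible p t a) :
    symbol (mono F p t a) = Finsupp.single a 1 := by
  rw [mono, dif_pos h, symbol_oddPartEquiv]

theorem mono_of_not_admissible {a : Mon n} (h : ¬ Admissible p t a) : mono F p t a = 0 := by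
  rw [mono, dif_neg h]

theorem symbol_mono_apply_of_ne {a b : Mon n} (h : a ≠ b) : symbol (mono F p t a) b = 0 := by
  by_cases ha : Admissible p t a
  · rw [symbol_mono ha, Finsupp.single_eq_of_ne' h]
  · rw [mono_of_not_admissible ha, symbol_zero, Finsupp.zero_apply]

theorem linearMap_eq_zero {M : Type*} [AddCommGroup M] [Module F M] (D : evenHO F p t →ₗ[F] M)
    (h : ∀ a, Admissible p t a → D (mono F p t a) = 0) : D = 0 := by
  have key : ∀ f : O F n, ∀ hf : f ∈ oddPart F p t, D (oddPartEquiv F p t ⟨f, hf⟩) = 0 := by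
    intro f hf
    have e : (⟨f, hf⟩ : oddPart F p t) = ∑ a ∈ f.support.attach,
        f a • ⟨Finsupp.single a.1 1, Finsupp.single_mem_supported F 1 (hf a.2)⟩ := by
      apply Subtype.ext
      rw [AddSubmonoidClass.coe_finsetSum]
      simp only [SetLike.val_smul, Finsupp.smul_single, smul_eq_mul, mul_one]
      rw [Finset.sum_attach f.support fun a => Finsupp.single a (f a)]
      exact (Finsupp.sum_single f).symm
    rw [e, map_sum, map_sum]
    refine Finset.sum_eq_zero fun a _ => ?_
    rw [map_smul, map_smul]
    have := h a.1 (hf a.2)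
    rw [mono, dif_pos (show Admissible p t a.1 from hf a.2)] at this
    rw [this, smul_zero]
  ext x
  obtain ⟨f, rfl⟩ := (oddPartEquiv F p t).surjective x
  exact key f.1 f.2

theorem lie_mono_eq {a b c : Mon n} {x : F} (ha : Admissible p t a) (hb : Admissible p t b)
    (hc : Admissible p t c)
    (h : TH F n (Finsupp.single a 1) (Finsupp.single b 1) = x • Finsupp.single c 1) :
    ⁅mono F p t a, mono F p t b⁆ = x • mono F p t c := by
  apply symbol_injective
  rw [symbol_lie, symbol_mono ha, symbol_mono hb, h, symbol_smul, symbol_mono hc]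

theorem pow_pos_of_prime (p : ℕ) [Fact p.Prime] (k : ℕ) : 0 < p ^ k :=
  pow_pos (Fact.out : p.Prime).pos k

theorem admissible_const {u : Finset (Fin n)} (hu : Odd u.card) : Admissible p t (0, u) :=
  ⟨fun i => pow_pos_of_prime p (t i), hu⟩

theorem admissible_single {i : Fin n} {m : ℕ} {u : Finset (Fin n)} (hm : m < p ^ t i)
    (hu : Odd u.card) : Admissible p t (Pi.single i m, u) := by
  refine ⟨fun j => ?_, hu⟩
  by_cases hj : j = i
  · subst hj; simpa using hm
  · simpa [hj] using pow_pos_of_prime p (t j)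

/-! ### The adjoint action of the ξ_i and of the torus -/

theorem lie_xi_apply (i : Fin n) (x : evenHO F p t) (α : Fin n → ℕ) (u : Finset (Fin n)) :
    symbol ⁅mono F p t (0, {i}), x⁆ (α, u) = -symbol x (α + Pi.single i 1, u) := by
  rw [symbol_lie, symbol_mono (admissible_const (by simp)), TH_odd_coordinate, Finsupp.neg_apply,
    partialD_inl_apply]

theorem lie_xi_mono (i : Fin n) {a : Mon n} (ha : Admissible p t a) :
    ⁅mono F p t (0, {i}), mono F p t a⁆ =
      if a.1 i = 0 then 0 else -mono F p t (a.1 - Pi.single i 1, a.2) := by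
  apply symbol_injective
  rw [symbol_lie, symbol_mono (admissible_const (by simp)), TH_odd_coordinate, symbol_mono ha,
    partialD_single, monPartial, one_smul]
  split_ifs
  · simp
  · rw [symbol_neg, symbol_mono]
    exact ⟨fun j => lt_of_le_of_lt (Nat.sub_le _ _) (ha.1 j), ha.2⟩

theorem one_lt_pow_of_prime {p : ℕ} [Fact p.Prime] {k : ℕ} (hk : 1 ≤ k) : 1 < p ^ k :=
  Nat.one_lt_pow (by omega) (Fact.out : p.Prime).one_lt

theorem lie_torus_apply {i : Fin n} (ht : 1 ≤ t i) (x : evenHO F p t) (a : Mon n) :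
    symbol ⁅mono F p t (Pi.single i 1, {i}), x⁆ a = weight F a i * symbol x a := by
  rw [symbol_lie, symbol_mono (admissible_single (one_lt_pow_of_prime ht) (by simp)),
    TH_torus_apply]

theorem lie_torus_mono {i : Fin n} (ht : 1 ≤ t i) (a : Mon n) :
    ⁅mono F p t (Pi.single i 1, {i}), mono F p t a⁆ = weight F a i • mono F p t a := by
  refine symbol_ext fun b _ => ?_
  rw [lie_torus_apply ht, symbol_smul, Finsupp.smul_apply, smul_eq_mul]
  by_cases h : a = b
  · rw [h]
  · rw [symbol_mono_apply_of_ne h, mul_zero, mul_zero]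

/-- The operator of `𝓗𝓞` that multiplies the basis element of `x^(α) x^u` by `|u| - 1`. -/
def degreeOperator (F : Type*) [Field F] (p : ℕ) [Fact p.Prime] [CharP F p] (t : Fin n → ℕ) :
    evenHO F p t →ₗ[F] evenHO F p t :=
  (oddPartEquiv F p t).toLinearMap ∘ₗ
    ((extDegree F n).restrict fun _ hf => extDegree_mem_oddPart hf) ∘ₗ
      (oddPartEquiv F p t).symm.toLinearMap - LinearMap.id

theorem symbol_degreeOperator (x : evenHO F p t) :
    symbol (degreeOperator F p t x) = extDegree F n (symbol x) - symbol x := by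
  rw [degreeOperator, LinearMap.sub_apply, symbol_sub, LinearMap.comp_apply,
    LinearEquiv.coe_coe, symbol_oddPartEquiv]
  rfl

/-- The operator `|u| - 1` as a derivation of `𝓗𝓞`. -/
def degreeDerivation (F : Type*) [Field F] (p : ℕ) [Fact p.Prime] [CharP F p] (t : Fin n → ℕ) :
    LieDerivation F (evenHO F p t) (evenHO F p t) where
  toLinearMap := degreeOperator F p t
  leibniz' x y := by
    rw [← lie_skew y, sub_neg_eq_add]
    apply symbol_injective
    simp only [symbol_degreeOperator, symbol_add, symbol_lie, extDegree_TH (symbol_odd x),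
      map_sub, LinearMap.sub_apply]
    abel

theorem symbol_degreeDerivation (x : evenHO F p t) (a : Mon n) :
    symbol (degreeDerivation F p t x) a = ((a.2.card : F) - 1) * symbol x a := by
  have : symbol (degreeDerivation F p t x) = extDegree F n (symbol x) - symbol x :=
    symbol_degreeOperator x
  rw [this, Finsupp.sub_apply, extDegree_apply]
  ring

end

/-! ### Structure constants between monomials -/

section

theorem ad_apply_eq_lie {L : Type*} [LieRing L] [LieAlgebra F L] (b x : L) :
    LieDerivation.ad F L b x = ⁅b, x⁆ := by
  simp

variable {p : ℕ} [Fact p.Prime] [CharP F p] {t : Fin n → ℕ}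

/-- The bound on m + γ_i - 1 keeps the resulting monomial inside the truncation, so the binomial
coefficient is the only thing that can make the bracket vanish. -/
theorem lie_power_vector {i k : Fin n} (hik : k ≠ i) {m : ℕ} {γ : Fin n → ℕ} (hγi : γ i ≠ 0)
    (hm : m < p ^ t i) (hγ : ∀ j, γ j < p ^ t j) (h : m + γ i - 1 < p ^ t i) :
    ⁅mono F p t (Pi.single i m, {i}), mono F p t (γ, {k})⁆ =
      -((m + γ i - 1).choose m : F) • mono F p t (Pi.single i m + (γ - Pi.single i 1), {k}) := by
  refine lie_mono_eq (admissible_single hm (by simp)) ⟨hγ, by simp⟩ ⟨fun j => ?_, by simp⟩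
    (TH_power_vector hik m γ hγi)
  by_cases hj : j = i
  · subst hj
    simp only [Pi.add_apply, Pi.single_eq_same, Pi.sub_apply]
    omega
  · simpa [hj] using hγ j

theorem lie_exchange {i j : Fin n} (ht : 1 ≤ t i) {s : Finset (Fin n)} (hs : Odd s.card)
    (hi : i ∈ s) (hj : j ∉ s) :
    ∃ c : F, c ≠ 0 ∧ ⁅mono F p t (Pi.single i 1, {j}), mono F p t (0, s)⁆ =
      c • mono F p t (0, insert j (s.erase i)) := by
  obtain ⟨c, hc, h⟩ := TH_exchange (F := F) hi hj
  refine ⟨c, hc, lie_mono_eq (admissible_single (one_lt_pow_of_prime ht) (by simp))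
    (admissible_const hs) (admissible_const ?_) h⟩
  rw [Finset.card_insert_of_notMem fun h => hj (Finset.mem_erase.1 h).2,
    Finset.card_erase_add_one hi]
  exact hs

theorem lie_trivector {k a b : Fin n} {α : Fin n → ℕ} {v : Finset (Fin n)} (hv : Odd v.card)
    (hk : k ∈ v) (ha : a ∉ v) (hb : b ∉ v) (hab : a ≠ b) (hα : ∀ i, α i < p ^ t i)
    (hαk : α k + 1 < p ^ t k) :
    ∃ c : F, c ≠ 0 ∧ ⁅mono F p t (α + Pi.single k 1, v), mono F p t (0, {k, a, b})⁆ =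
      c • mono F p t (α, v ∪ {a, b}) := by
  have hka : k ≠ a := fun h => ha (h ▸ hk)
  have hkb : k ≠ b := fun h => hb (h ▸ hk)
  obtain ⟨c, hc, h⟩ := TH_trivector (F := F) (α := α) hv hk ha hb hab
  refine ⟨c, hc, lie_mono_eq ⟨fun j => ?_, hv⟩ (admissible_const ?_) ⟨hα, ?_⟩ h⟩
  · by_cases hj : j = k
    · subst hj; simpa using hαk
    · simpa [hj] using hα j
  · rw [Finset.card_eq_three.2 ⟨k, a, b, hka, hkb, hab, rfl⟩]
    decide
  · have : (v ∪ {a, b}).card = v.card + 2 := by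
      rw [Finset.card_union_of_disjoint, Finset.card_pair hab]
      rw [Finset.disjoint_right]
      intro x hx
      rcases Finset.mem_insert.1 hx with rfl | hx
      · exact ha
      · rw [Finset.mem_singleton.1 hx]; exact hb
    change Odd (v ∪ {a, b}).card
    rw [this]
    exact hv.add_even even_two

theorem weight_xi (i k : Fin n) : weight F (0, {i}) k = if k = i then 1 else 0 := by
  simp [weight]

theorem weight_const (u : Finset (Fin n)) (k : Fin n) :
    weight F (0, u) k = if k ∈ u then 1 else 0 := by
  simp [weight]

theorem lie_xi_torus (i k : Fin n) (ht : 1 ≤ t k) :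
    ⁅mono F p t (0, {i}), mono F p t (Pi.single k 1, {k})⁆ =
      (if k = i then -1 else 0 : F) • mono F p t (0, {i}) := by
  rw [← lie_skew, lie_torus_mono ht, weight_xi]
  split_ifs <;> simp

/-! ### Normalization by inner derivations -/

section Integration

variable (D : LieDerivation F (evenHO F p t) (evenHO F p t))

/-- Applying D to [ξ_i, ξ_j] = 0 gives ∂_j D(ξ_i) = ∂_i D(ξ_j), the integrability condition for the
system ∂_i b = D(ξ_i). -/
theorem closed_of_derivation (i j : Fin n) (α : Fin n → ℕ) (u : Finset (Fin n)) :
    symbol (D (mono F p t (0, {i}))) (α + Pi.single j 1, u) =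
      symbol (D (mono F p t (0, {j}))) (α + Pi.single i 1, u) := by
  have h0 : ⁅mono F p t (0, {i}), mono F p t (0, {j})⁆ = 0 := by
    rw [lie_xi_mono i (admissible_const (by simp))]
    exact if_pos rfl
  have h1 := D.apply_lie_eq_sub (mono F p t (0, {i})) (mono F p t (0, {j}))
  rw [h0, map_zero, eq_comm, sub_eq_zero] at h1
  have h2 := congrArg (fun x => symbol x (α, u)) h1
  simp only [lie_xi_apply] at h2
  exact (neg_injective h2).symm

/-- In the truncated algebra a monomial with the top exponent p^(t_i) - 1 has no ∂_i-primitive, so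
closedness alone does not suffice for integration. This removes the remaining obstruction. -/
theorem symbol_derivation_xi_top (ht : ∀ i, 1 ≤ t i) (i : Fin n) (α : Fin n → ℕ)
    (u : Finset (Fin n)) (hα : α i + 1 = p ^ t i) :
    symbol (D (mono F p t (0, {i}))) (α, u) = 0 := by
  set c := symbol (D (mono F p t (0, {i}))) (α, u) with hc
  have hout : ∀ (x : evenHO F p t) (β : Fin n → ℕ), p ^ t i ≤ β i → symbol x (β, u) = 0 :=
    fun x β hβ => symbol_apply_of_not_admissible x fun h => absurd (h.1 i) (by simpa using hβ)
  by_cases hex : ∃ k, k ≠ i ∧ α k ≠ 0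
  · obtain ⟨k, hki, hk⟩ := hex
    have e : α - Pi.single k 1 + Pi.single k 1 = α := by
      ext j
      by_cases hj : j = k
      · subst hj; simp; omega
      · simp [hj]
    -- Closedness trades one factor x_k for one factor x_i, which pushes the exponent of x_i beyond
    -- the truncation.
    rw [hc, ← e, closed_of_derivation]
    refine hout _ _ ?_
    simp [hki.symm]
    omega
  · push Not at hex
    -- When x_i is the only even variable left, D is applied to [ξ_i, x_k ξ_k]. The term with D(x_k
    -- ξ_k) drops out because its exponent of x_i is p^(t_i).
    have hmain : ∀ k, ((if k = i then -1 else 0) + weight F (α, u) k) * c = 0 := by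
      intro k
      have h1 := D.apply_lie_eq_sub (mono F p t (0, {i})) (mono F p t (Pi.single k 1, {k}))
      rw [lie_xi_torus i k (ht k), map_smul] at h1
      have h2 := congrArg (fun x => symbol x (α, u)) h1
      simp only [symbol_smul, symbol_sub, Finsupp.smul_apply, Finsupp.sub_apply, lie_xi_apply,
        lie_torus_apply (ht k), smul_eq_mul] at h2
      rw [hout _ (α + Pi.single i 1) (by simp [hα])] at h2
      linear_combination h2
    rcases u.eq_empty_or_nonempty with rfl | ⟨k, hk⟩
    · exact symbol_apply_of_not_admissible _ fun h => by simpa using h.2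
    · have h := hmain k
      -- For k = i, the exponent α_i equals -1 in F, so the weight is 2 and the factor is -1 + 2;
      -- for k ≠ i the exponent α_k is 0 and the weight is already 1.
      have h1 : (if k = i then (-1 : F) else 0) + weight F (α, u) k = 1 := by
        by_cases hki : k = i
        · subst hki
          have h2 := congrArg (Nat.cast : ℕ → F) hα
          have h3 := ht k
          push_cast at h2
          rw [CharP.cast_eq_zero F p, zero_pow (by omega)] at h2
          simp only [weight, if_true, hk]
          linear_combination -h2
        · simp [weight, hki, hk, hex k hki]
      rwa [h1, one_mul] at h

/-- Every derivation agrees with an inner derivation on the odd coordinates. -/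
theorem exists_ad_eq_on_xi (ht : ∀ i, 1 ≤ t i) :
    ∃ b : evenHO F p t, ∀ i, D (mono F p t (0, {i})) = ⁅b, mono F p t (0, {i})⁆ := by
  classical
  -- The primitive b must satisfy ∂_i b = D(ξ_i). Any variable that occurs may be used to read off
  -- its coefficients, by closedness. The part free of x is arbitrary and is set to zero.
  let f : Mon n → F := fun a => if h : ∃ i, a.1 i ≠ 0 then
    symbol (D (mono F p t (0, {h.choose}))) (a.1 - Pi.single h.choose 1, a.2) else 0
  have hadd : ∀ (α : Fin n → ℕ) i, α i ≠ 0 → α - Pi.single i 1 + Pi.single i 1 = α := by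
    intro α i hi
    ext j
    by_cases hj : j = i
    · subst hj; simp; omega
    · simp [hj]
  have hf : ∀ a i, a.1 i ≠ 0 →
      f a = symbol (D (mono F p t (0, {i}))) (a.1 - Pi.single i 1, a.2) := by
    intro a i hi
    have hex : ∃ i, a.1 i ≠ 0 := ⟨i, hi⟩
    simp only [f, dif_pos hex]
    set j := hex.choose with hj
    have hj0 : a.1 j ≠ 0 := hex.choose_spec
    by_cases hij : i = j
    · rw [hij]
    · have e1 : a.1 - Pi.single j 1 = a.1 - Pi.single j 1 - Pi.single i 1 + Pi.single i 1 :=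
        (hadd _ i (by simpa [hij] using hi)).symm
      have e2 : a.1 - Pi.single i 1 = a.1 - Pi.single j 1 - Pi.single i 1 + Pi.single j 1 := by
        rw [tsub_right_comm]
        exact (hadd _ j (by simpa [Ne.symm hij] using hj0)).symm
      rw [e1, e2, closed_of_derivation]
  obtain ⟨b, hb⟩ := exists_symbol_apply (F := F) (p := p) (t := t) f (by
    intro a ha
    by_contra h0
    by_cases hex : ∃ i, a.1 i ≠ 0
    · obtain ⟨i, hi⟩ := hex
      rw [hf a i hi] at h0
      have h1 : Admissible p t (a.1 - Pi.single i 1, a.2) :=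
        by_contra fun h => h0 (symbol_apply_of_not_admissible _ h)
      refine ha ⟨fun j => ?_, h1.2⟩
      by_cases hj : j = i
      · subst hj
        -- If the shifted monomial is admissible but this one is not, its exponent of x_j is
        -- p^(t_j), so the coefficient in question is a top one and vanishes.
        by_contra h2
        refine h0 (symbol_derivation_xi_top D ht j _ _ ?_)
        have := h1.1 j
        simp only [Pi.sub_apply, Pi.single_eq_same] at this ⊢
        omega
      · simpa [hj] using h1.1 j
    · simp only [f, dif_neg hex] at h0
      exact h0 trivial)
  refine ⟨b, fun i => symbol_ext fun a _ => ?_⟩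
  rw [← lie_skew, symbol_neg, Finsupp.neg_apply, lie_xi_apply, neg_neg, hb,
    hf _ i (by simp), add_tsub_cancel_right]

end Integration

/-- Commuting with every ξ_i means being annihilated by every ∂_i, hence being free of the even
variables. -/
theorem symbol_apply_of_lie_xi_eq_zero {x : evenHO F p t}
    (h : ∀ i, ⁅mono F p t (0, {i}), x⁆ = 0) {a : Mon n} (ha : a.1 ≠ 0) : symbol x a = 0 := by
  obtain ⟨i, hi⟩ := Function.ne_iff.1 ha
  have h1 := congrArg (fun y => symbol y (a.1 - Pi.single i 1, a.2)) (h i)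
  simp only [lie_xi_apply, symbol_zero, Finsupp.zero_apply, neg_eq_zero] at h1
  have e : a.1 - Pi.single i 1 + Pi.single i 1 = a.1 := by
    ext j
    by_cases hj : j = i
    · subst hj; simp at hi ⊢; omega
    · simp [hj]
  rwa [e] at h1

/-- A derivation that annihilates the odd coordinates `ξ_i` and the elements `x_i ξ_i`. -/
structure Normalized (D : LieDerivation F (evenHO F p t) (evenHO F p t)) : Prop where
  xi : ∀ i, D (mono F p t (0, {i})) = 0
  torus : ∀ i, D (mono F p t (Pi.single i 1, {i})) = 0

/-- The values D(x_i ξ_i) commute with all ξ_j, so they are free of x. Commutativity of the torus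
makes them, in each weight, proportional to the weight, as for an inner derivation. -/
theorem exists_ad_eq_on_torus (ht : ∀ i, 1 ≤ t i)
    {D : LieDerivation F (evenHO F p t) (evenHO F p t)}
    (hD : ∀ i, D (mono F p t (0, {i})) = 0) :
    ∃ b : evenHO F p t, (∀ i, ⁅b, mono F p t (0, {i})⁆ = 0) ∧
      ∀ i, D (mono F p t (Pi.single i 1, {i})) = ⁅b, mono F p t (Pi.single i 1, {i})⁆ := by
  classical
  have hconst : ∀ i, ∀ a : Mon n, a.1 ≠ 0 →
      symbol (D (mono F p t (Pi.single i 1, {i}))) a = 0 := by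
    intro i a ha
    refine symbol_apply_of_lie_xi_eq_zero (fun j => ?_) ha
    have h1 := D.apply_lie_eq_sub (mono F p t (0, {j})) (mono F p t (Pi.single i 1, {i}))
    rw [lie_xi_torus j i (ht i), map_smul, hD, smul_zero, lie_zero, sub_zero] at h1
    exact h1.symm
  have hcomm : ∀ i j a, weight F a i * symbol (D (mono F p t (Pi.single j 1, {j}))) a =
      weight F a j * symbol (D (mono F p t (Pi.single i 1, {i}))) a := by
    intro i j a
    have h1 := D.apply_lie_eq_sub (mono F p t (Pi.single i 1, {i}))
      (mono F p t (Pi.single j 1, {j}))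
    have h0 : weight F (Pi.single j 1, {j}) i = 0 := by
      by_cases h : i = j
      · subst h; simp [weight]
      · simp [weight, h]
    rw [lie_torus_mono (ht i), h0, zero_smul, map_zero, eq_comm, sub_eq_zero] at h1
    have h2 := congrArg (fun x => symbol x a) h1
    simpa only [lie_torus_apply (ht _)] using h2
  -- The coefficient of D(x_k ξ_k) would be divided by minus the k-th weight. For k ∈ u the weight
  -- of ξ^u is 1, so only the sign remains.
  let f : Mon n → F := fun a => if h : a.1 = 0 ∧ a.2.Nonempty then
    -symbol (D (mono F p t (Pi.single h.2.choose 1, {h.2.choose}))) a else 0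
  obtain ⟨b, hb⟩ := exists_symbol_apply (F := F) (p := p) (t := t) f (by
    intro a ha
    simp only [f]
    split_ifs with h
    · rw [symbol_apply_of_not_admissible _ ha, neg_zero]
    · rfl)
  refine ⟨b, fun i => ?_, fun i => ?_⟩
  · rw [← lie_skew, neg_eq_zero]
    refine symbol_ext fun a _ => ?_
    rw [lie_xi_apply, hb, symbol_zero, Finsupp.zero_apply, neg_eq_zero]
    exact dif_neg fun h => by simpa using congrFun h.1 i
  · rw [← lie_skew]
    refine symbol_ext fun a ha => ?_
    rw [symbol_neg, Finsupp.neg_apply, lie_torus_apply (ht i), hb]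
    by_cases h0 : a.1 = 0
    · have hne : a.2.Nonempty := by
        rw [Finset.nonempty_iff_ne_empty]
        intro h
        have := ha.2
        rw [h] at this
        simp at this
      have hex : a.1 = 0 ∧ a.2.Nonempty := ⟨h0, hne⟩
      simp only [f, dif_pos hex]
      rw [mul_neg, neg_neg, hcomm]
      have h1 : hex.2.choose ∈ a.2 := hex.2.choose_spec
      simp [weight, h1, h0]
    · rw [hconst i a h0]
      have : f a = 0 := dif_neg fun h => h0 h.1
      rw [this, mul_zero, neg_zero]

/-- The second correction commutes with every ξ_i, so it does not disturb the first. -/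
theorem exists_normalized_sub_ad (ht : ∀ i, 1 ≤ t i)
    (D : LieDerivation F (evenHO F p t) (evenHO F p t)) :
    ∃ b : evenHO F p t, Normalized (D - LieDerivation.ad F (evenHO F p t) b) := by
  obtain ⟨b, hb⟩ := exists_ad_eq_on_xi D ht
  have h1 : ∀ i, (D - LieDerivation.ad F (evenHO F p t) b) (mono F p t (0, {i})) = 0 := by
    intro i
    rw [LieDerivation.sub_apply, hb, ad_apply_eq_lie,
      sub_self]
  obtain ⟨c, hc, hc'⟩ := exists_ad_eq_on_torus ht h1
  refine ⟨b + c, fun i => ?_, fun i => ?_⟩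
  · rw [map_add, ← sub_sub, LieDerivation.sub_apply, h1,
      ad_apply_eq_lie, hc, sub_zero]
  · rw [map_add, ← sub_sub, LieDerivation.sub_apply, hc',
      ad_apply_eq_lie, sub_self]

end

/-! ### Binomial coefficients modulo p -/

section

/-- Lucas' congruence strips one common factor p from both entries at a time, until the binomial
coefficient is r choose 1. -/
theorem choose_prime_pow_mul_modEq (p : ℕ) [Fact p.Prime] (v r : ℕ) :
    (p ^ v * r).choose (p ^ v) ≡ r [MOD p] := by
  induction v with
  | zero => simp; rfl
  | succ v ih =>
    have h := Choose.choose_modEq_choose_mod_mul_choose_div_nat (p := p) (n := p ^ (v + 1) * r)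
      (k := p ^ (v + 1))
    have hp : 0 < p := (Fact.out : p.Prime).pos
    have e1 : p ^ (v + 1) * r = p * (p ^ v * r) := by ring
    have e2 : p ^ (v + 1) = p * p ^ v := by ring
    rw [e1, e2, Nat.mul_mod_right, Nat.mul_mod_right, Nat.mul_div_cancel_left _ hp,
      Nat.mul_div_cancel_left _ hp, Nat.choose_self, one_mul] at h
    rw [e1, e2]
    exact h.trans ih

theorem sum_sub_single (α : Fin n → ℕ) (i : Fin n) (hi : α i ≠ 0) :
    ∑ j, (α - Pi.single i 1 : Fin n → ℕ) j + 1 = ∑ j, α j := by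
  rw [← Finset.add_sum_erase _ _ (Finset.mem_univ i), ← Finset.add_sum_erase _ α
    (Finset.mem_univ i), Finset.sum_congr rfl (g := fun j => α j)]
  · simp only [Pi.sub_apply, Pi.single_eq_same]
    omega
  · intro j hj
    simp [Finset.ne_of_mem_erase hj]

/-- Monomials free of x have only the weights 0 and 1. In odd characteristic -1 is neither, which
excludes such values on monomials of weight -1. -/
theorem neg_one_ne {p : ℕ} [CharP F p] (hp : 2 < p) (P : Prop) [Decidable P] :
    (-1 : F) ≠ if P then 1 else 0 := by
  have h2 : (2 : F) ≠ 0 := by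
    have := (CharP.cast_eq_zero_iff F p 2).not.2 fun h => absurd (Nat.le_of_dvd (by simp) h)
      (by omega)
    simpa using this
  split_ifs
  · intro h; exact h2 (by linear_combination -h)
  · simp

variable {p : ℕ} [Fact p.Prime] [CharP F p] {t : Fin n → ℕ}

/-- Take for q the exact power p^v dividing m = p^v r: then m choose q is r mod p. It exceeds 1
because p divides m, and is below m because m is no power of p. -/
theorem exists_choose_ne_zero {m : ℕ} (hm : m ≠ 0) (hpm : (m : F) = 0) (h : ∀ v, m ≠ p ^ v) :
    ∃ q, 1 < q ∧ q < m ∧ (m.choose q : F) ≠ 0 := by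
  have hpp : p.Prime := Fact.out
  rw [CharP.cast_eq_zero_iff F p] at hpm
  obtain ⟨v, r, hr, rfl⟩ := Nat.exists_eq_pow_mul_and_not_dvd hm p hpp.ne_one
  have hv : v ≠ 0 := by rintro rfl; simp at hpm; exact hr hpm
  have h1 : 1 < p ^ v := Nat.one_lt_pow hv hpp.one_lt
  refine ⟨p ^ v, h1, ?_, ?_⟩
  · have hr1 : r ≠ 1 := by rintro rfl; exact h v (by simp)
    have hr0 : r ≠ 0 := by rintro rfl; simp at hr
    have : 2 ≤ r := by omega
    nlinarith
  · rw [Ne, CharP.cast_eq_zero_iff F p, (choose_prime_pow_mul_modEq p v r).dvd_iff dvd_rfl]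
    exact hr

theorem eq_zero_iff_symbol (x : evenHO F p t) : x = 0 ↔ ∀ a, symbol x a = 0 :=
  ⟨fun h a => by rw [h]; simp, fun h => symbol_ext fun a _ => by rw [h]; simp⟩

/-! ### Normalized derivations on the vectors x^(α) ξ_k -/

section Normalized

variable {D : LieDerivation F (evenHO F p t) (evenHO F p t)}

namespace Normalized

/-- A derivation that kills x_i ξ_i commutes with its adjoint action, hence preserves the
eigenspaces. -/
theorem weight_eq (hD : Normalized D) (ht : ∀ i, 1 ≤ t i) {a b : Mon n}
    (h : symbol (D (mono F p t b)) a ≠ 0) (i : Fin n) : weight F b i = weight F a i := by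
  have h1 := D.apply_lie_eq_sub (mono F p t (Pi.single i 1, {i})) (mono F p t b)
  rw [lie_torus_mono (ht i), map_smul, hD.torus, lie_zero, sub_zero] at h1
  have h2 := congrArg (fun x => symbol x a) h1
  simp only [lie_torus_apply (ht i), symbol_smul, Finsupp.smul_apply, smul_eq_mul] at h2
  exact mul_right_cancel₀ h h2

/-- Since D(ξ_i) = 0, D commutes with ∂_i; if it kills the derivatives of a monomial, then its value
on the monomial has zero derivatives. -/
theorem const_of_lower (hD : Normalized D) {b : Mon n} (hb : Admissible p t b)
    (h : ∀ i, b.1 i ≠ 0 → D (mono F p t (b.1 - Pi.single i 1, b.2)) = 0) {a : Mon n}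
    (ha : symbol (D (mono F p t b)) a ≠ 0) : a.1 = 0 := by
  by_contra h0
  refine ha (symbol_apply_of_lie_xi_eq_zero (fun i => ?_) h0)
  have h1 := D.apply_lie_eq_sub (mono F p t (0, {i})) (mono F p t b)
  rw [hD.xi, lie_zero, sub_zero, lie_xi_mono i hb] at h1
  rw [← h1]
  split_ifs with hi
  · exact map_zero _
  · rw [map_neg, h i hi, neg_zero]

theorem weight_of_lower (hD : Normalized D) (ht : ∀ i, 1 ≤ t i) {b : Mon n}
    (hb : Admissible p t b)
    (h : ∀ i, b.1 i ≠ 0 → D (mono F p t (b.1 - Pi.single i 1, b.2)) = 0) {a : Mon n}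
    (ha : symbol (D (mono F p t b)) a ≠ 0) (i : Fin n) :
    weight F b i = if i ∈ a.2 then 1 else 0 := by
  rw [hD.weight_eq ht ha i, weight, hD.const_of_lower hb h ha]
  simp

/-- The vectors `x^(α) ξ_k` of lower degree are annihilated. -/
def LowerVectors (D : LieDerivation F (evenHO F p t) (evenHO F p t)) (N : ℕ) : Prop :=
  ∀ (β : Fin n → ℕ) (l : Fin n), (∀ i, β i < p ^ t i) → ∑ i, β i < N →
    D (mono F p t (β, {l})) = 0

theorem lower_vector {N : ℕ} (hlow : LowerVectors D N) {α : Fin n → ℕ} (hα : ∀ i, α i < p ^ t i)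
    (hN : ∑ i, α i = N) (k i : Fin n) (hi : α i ≠ 0) :
    D (mono F p t (α - Pi.single i 1, {k})) = 0 := by
  refine hlow _ _ (fun j => lt_of_le_of_lt (Nat.sub_le _ _) (hα j)) ?_
  have := sum_sub_single α i hi
  omega

/-- The weights at indices other than i decide the exterior part of the value away from i, and
oddness of its cardinality decides membership of i. Comparing the weights at i then forces N = 0 in
F. -/
theorem pure_power_support (hD : Normalized D) (ht : ∀ i, 1 ≤ t i) {N : ℕ}
    (hlow : LowerVectors D N) {i k : Fin n} (hN : N < p ^ t i) {a : Mon n}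
    (ha : symbol (D (mono F p t (Pi.single i N, {k}))) a ≠ 0) :
    a = (0, {k}) ∧ (N : F) = 0 := by
  have hadm : Admissible p t (Pi.single i N, {k}) := admissible_single hN (by simp)
  have hl : ∀ j, (Pi.single i N : Fin n → ℕ) j ≠ 0 →
      D (mono F p t (Pi.single i N - Pi.single j 1, {k})) = 0 :=
    fun j hj => lower_vector hlow hadm.1 (by simp) k j hj
  have h0 := hD.const_of_lower hadm hl ha
  have hw := hD.weight_of_lower ht hadm hl ha
  have hodd : Odd a.2.card := by
    by_contra h
    exact ha (symbol_apply_of_not_admissible _ fun h' => h h'.2)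
  have hne : ∀ j, j ≠ i → (j ∈ a.2 ↔ j = k) := by
    intro j hj
    have := hw j
    simp only [weight, Finset.mem_singleton, Pi.single_eq_of_ne hj, Nat.cast_zero, sub_zero] at this
    split_ifs at this <;> simp_all
  have hi : i ∈ a.2 ↔ i = k := by
    by_cases hik : i = k
    · refine iff_of_true ?_ hik
      by_contra hia
      have : a.2 = ∅ := by
        ext j
        by_cases hj : j = i
        · subst hj; simp [hia]
        · rw [hne j hj, ← hik]; simp [hj]
      rw [this] at hodd
      simp at hodd
    · refine iff_of_false (fun hia => ?_) hik
      have : a.2 = {i, k} := by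
        ext j
        by_cases hj : j = i
        · subst hj; simp [hia]
        · rw [hne j hj]; simp [hj]
      rw [this, Finset.card_pair hik] at hodd
      exact absurd hodd (by decide)
  have h2 : a.2 = {k} := by
    ext j
    rw [Finset.mem_singleton]
    by_cases hj : j = i
    · rw [hj, hi]
    · exact hne j hj
  refine ⟨Prod.ext h0 h2, ?_⟩
  have := hw i
  simp only [weight, Pi.single_eq_same, h2] at this
  linear_combination -this

/-- Passing from `x_i^(m) ξ_i` to `x_i^(m) ξ_k`. -/
theorem lie_power_rotate {i k : Fin n} (hik : k ≠ i) {m : ℕ} (hm : m < p ^ t i)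
    (ht : ∀ i, 1 ≤ t i) :
    ⁅mono F p t (Pi.single i m, {i}), mono F p t (Pi.single i 1, {k})⁆ =
      -mono F p t (Pi.single i m, {k}) := by
  rw [lie_power_vector hik (by simp) hm
    (admissible_single (u := {k}) (one_lt_pow_of_prime (ht i)) (by simp)).1 (by simpa using hm)]
  simp

/-- Only N divisible by p needs an argument. If N = p^v, then x_i^(N) ξ_k is up to sign the bracket
of x_i^(N) ξ_i, killed by hypothesis, with x_i ξ_k. Otherwise it comes from two vectors of lower
degree with the nonzero coefficient N choose q. -/
theorem pure_power_eq_zero_of_ne (hD : Normalized D) (ht : ∀ i, 1 ≤ t i)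
    (hpow : ∀ i v, 1 ≤ v → v < t i → symbol (D (mono F p t (Pi.single i (p ^ v), {i})))
      (0, {i}) = 0) {N : ℕ}
    (hlow : LowerVectors D N) {i k : Fin n} (hN : N < p ^ t i) (hik : k ≠ i) (hN0 : N ≠ 0) :
    D (mono F p t (Pi.single i N, {k})) = 0 := by
  rw [eq_zero_iff_symbol]
  intro a
  by_contra ha
  obtain ⟨-, hNF⟩ := hD.pure_power_support ht hlow hN ha
  have hN1 : 1 < N := by
    rcases Nat.lt_or_ge 1 N with h | h
    · exact h
    · have : N = 1 := by omega
      simp [this] at hNF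
  apply ha
  suffices h : D (mono F p t (Pi.single i N, {k})) = 0 by rw [h]; simp
  by_cases hv : ∃ v, N = p ^ v
  · obtain ⟨v, rfl⟩ := hv
    have h1 : D (mono F p t (Pi.single i (p ^ v), {i})) = 0 := by
      rw [eq_zero_iff_symbol]
      intro b
      by_contra hb
      obtain ⟨rfl, -⟩ := hD.pure_power_support ht hlow hN hb
      refine hb (hpow i v ?_ ?_)
      · rcases v with _ | v
        · simp at hN1
        · omega
      · exact (Nat.pow_lt_pow_iff_right (Fact.out : p.Prime).one_lt).1 hN
    have h2 : D (mono F p t (Pi.single i 1, {k})) = 0 :=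
      hlow _ _ (admissible_single (u := {k}) (one_lt_pow_of_prime (ht i)) (by simp)).1
        (by simpa using hN1)
    have h3 := D.apply_lie_eq_sub (mono F p t (Pi.single i (p ^ v), {i}))
      (mono F p t (Pi.single i 1, {k}))
    rw [lie_power_rotate hik hN ht, h1, h2, lie_zero, lie_zero, sub_zero, map_neg,
      neg_eq_zero] at h3
    exact h3
  · push Not at hv
    obtain ⟨q, hq1, hqN, hq⟩ := exists_choose_ne_zero hN0 hNF hv
    -- The bracket consumes one x_i, so the second factor has exponent N - q + 1; this is below N
    -- precisely because q > 1.
    have hc : N - q + 1 < N := by omega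
    have h1 : D (mono F p t (Pi.single i q, {i})) = 0 :=
      hlow _ _ (admissible_single (u := {k}) (hqN.trans hN) (by simp)).1 (by simpa using hqN)
    have hadm2 := (admissible_single (p := p) (t := t) (i := i) (u := {k}) (hc.trans hN)
      (by simp)).1
    have h2 : D (mono F p t (Pi.single i (N - q + 1), {k})) = 0 :=
      hlow _ _ hadm2 (by simpa using hc)
    have e : q + (Pi.single i (N - q + 1) : Fin n → ℕ) i - 1 = N := by
      simp only [Pi.single_eq_same]; omega
    have h3 := D.apply_lie_eq_sub (mono F p t (Pi.single i q, {i}))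
      (mono F p t (Pi.single i (N - q + 1), {k}))
    rw [lie_power_vector hik (by simp) (hqN.trans hN) hadm2 (by rw [e]; exact hN), h1, h2,
      lie_zero, lie_zero, sub_zero, map_smul, e] at h3
    have e2 : Pi.single i q + (Pi.single i (N - q + 1) - Pi.single i 1) =
        (Pi.single i N : Fin n → ℕ) := by
      ext j
      by_cases hj : j = i
      · subst hj; simp; omega
      · simp [hj]
    rw [e2] at h3
    exact (smul_eq_zero.1 h3).resolve_left (neg_ne_zero.2 hq)

theorem pure_power_eq_zero (hD : Normalized D) (ht : ∀ i, 1 ≤ t i) (hn : 2 ≤ n)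
    (hpow : ∀ i v, 1 ≤ v → v < t i → symbol (D (mono F p t (Pi.single i (p ^ v), {i})))
      (0, {i}) = 0) {N : ℕ}
    (hlow : LowerVectors D N) {i k : Fin n} (hN : N < p ^ t i) :
    D (mono F p t (Pi.single i N, {k})) = 0 := by
  rcases Nat.eq_zero_or_pos N with rfl | hN0
  · simpa using hD.xi k
  by_cases hik : k = i
  swap
  · exact hD.pure_power_eq_zero_of_ne ht hpow hlow hN hik hN0.ne'
  subst hik
  have : Nontrivial (Fin n) := Fin.nontrivial_iff_two_le.2 hn
  -- The value on x_k^(N) ξ_k is c ξ_k. Bracketing with x_k ξ_l gives a multiple of x_k^(N) ξ_l,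
  -- already killed, on one side and -c ξ_l on the other, so c = 0.
  obtain ⟨l, hl⟩ := exists_ne k
  have h1 := hD.pure_power_eq_zero_of_ne ht hpow hlow hN hl hN0.ne'
  have hsupp : ∀ a, a ≠ (0, {k}) → symbol (D (mono F p t (Pi.single k N, {k}))) a = 0 :=
    fun a ha => by_contra fun h => ha (hD.pure_power_support ht hlow hN h).1
  set c := symbol (D (mono F p t (Pi.single k N, {k}))) (0, {k}) with hc
  have hval : D (mono F p t (Pi.single k N, {k})) = c • mono F p t (0, {k}) := by
    refine symbol_ext fun a _ => ?_
    rw [symbol_smul, symbol_mono (admissible_const (by simp))]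
    by_cases ha : a = (0, {k})
    · subst ha; simp [hc]
    · rw [hsupp a ha]; simp [ha]
  by_cases hNF : (N : F) = 0
  swap
  · rw [eq_zero_iff_symbol]
    intro a
    by_contra h
    exact hNF (hD.pure_power_support ht hlow hN h).2
  have hN1 : 1 < N := by
    rcases Nat.lt_or_ge 1 N with h | h
    · exact h
    · have : N = 1 := by omega
      simp [this] at hNF
  have hadm : Admissible p t (Pi.single k 1, {l}) :=
    admissible_single (one_lt_pow_of_prime (ht k)) (by simp)
  have h2 : D (mono F p t (Pi.single k 1, {l})) = 0 := hlow _ _ hadm.1 (by simpa using hN1)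
  have h3 := D.apply_lie_eq_add (mono F p t (Pi.single k N, {k}))
    (mono F p t (Pi.single k 1, {l}))
  rw [lie_power_rotate hl hN ht, map_neg, h1, h2, hval, smul_lie, lie_xi_mono k hadm] at h3
  simp only [Pi.single_eq_same, one_ne_zero, if_false, tsub_self, lie_zero, zero_add, neg_zero,
    smul_neg, zero_eq_neg] at h3
  have h4 := congrArg (fun x => symbol x (0, {l})) h3
  simp only [symbol_smul, symbol_mono (admissible_const (p := p) (t := t) (u := {l}) (by simp)),
    Finsupp.smul_apply, Finsupp.single_eq_same, smul_eq_mul, mul_one, symbol_zero,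
    Finsupp.zero_apply] at h4
  rw [hval, h4, zero_smul]

/-- Induction on the total degree. Pure powers are settled; if some i ≠ k occurs along with another
variable, either the exponent 1 at i gives the forbidden weight -1, or the vector is a bracket of
two vectors of lower degree. -/
theorem vector_eq_zero (hD : Normalized D) (hp : 2 < p) (ht : ∀ i, 1 ≤ t i) (hn : 2 ≤ n)
    (hpow : ∀ i v, 1 ≤ v → v < t i → symbol (D (mono F p t (Pi.single i (p ^ v), {i})))
      (0, {i}) = 0) (N : ℕ) : LowerVectors D N := by
  induction N with
  | zero => intro β l _ h; omega
  | succ N ih =>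
    intro α k hα hN
    rcases Nat.lt_succ_iff_lt_or_eq.1 hN with hN | hN
    · exact ih α k hα hN
    have hpure : ∀ i, (∀ j, j ≠ i → α j = 0) → D (mono F p t (α, {k})) = 0 := by
      intro i hi
      have e : α = Pi.single i N := by
        have h1 : α i = N := by
          rw [← hN, Finset.sum_eq_single i]
          · intro j _ hj; exact hi j hj
          · simp
        ext j
        by_cases hj : j = i
        · subst hj; simp [h1]
        · simp [hj, hi j hj]
      rw [e]
      refine hD.pure_power_eq_zero ht hn hpow ih ?_
      have := hα i
      rwa [e, Pi.single_eq_same] at this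
    by_cases hA : ∃ i, i ≠ k ∧ α i ≠ 0
    swap
    · push Not at hA
      exact hpure k hA
    obtain ⟨i, hik, hi⟩ := hA
    by_cases hB : ∃ j, j ≠ i ∧ α j ≠ 0
    swap
    · push Not at hB
      exact hpure i hB
    obtain ⟨j, hji, hj⟩ := hB
    have hij : α i + α j ≤ N := by
      rw [← hN, ← Finset.add_sum_erase _ _ (Finset.mem_univ i)]
      exact Nat.add_le_add_left (Finset.single_le_sum (fun _ _ => Nat.zero_le _)
        (Finset.mem_erase.2 ⟨hji, Finset.mem_univ j⟩)) _
    by_cases hi1 : α i = 1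
    · rw [eq_zero_iff_symbol]
      intro a
      by_contra ha
      have := hD.weight_of_lower ht ⟨hα, by simp⟩ (lower_vector ih hα hN k) ha i
      simp only [weight, Finset.mem_singleton, hik, if_false, hi1, Nat.cast_one, zero_sub] at this
      exact neg_one_ne hp _ this
    -- Bracketing x_i^(α_i) ξ_i with x^(γ) ξ_k restores α with coefficient -1. The first factor has
    -- lower degree because α_j ≠ 0, the second because α_i > 1.
    · let γ : Fin n → ℕ := Function.update α i 1
      have hγi : γ i = 1 := by simp [γ]
      have hγ : ∀ j, γ j < p ^ t j := by
        intro j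
        by_cases h : j = i
        · subst h; rw [hγi]; exact one_lt_pow_of_prime (ht j)
        · simpa [γ, h] using hα j
      have hγN : ∑ j, γ j < N := by
        rw [← hN]
        refine Finset.sum_lt_sum (fun j _ => ?_) ⟨i, Finset.mem_univ i, by rw [hγi]; omega⟩
        by_cases h : j = i
        · subst h; rw [hγi]; omega
        · simp [γ, h]
      have h1 : D (mono F p t (Pi.single i (α i), {i})) = 0 :=
        ih _ _ (admissible_single (u := {k}) (hα i) (by simp)).1 (by simp; omega)
      have h2 : D (mono F p t (γ, {k})) = 0 := ih _ _ hγ hγN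
      have h3 := D.apply_lie_eq_sub (mono F p t (Pi.single i (α i), {i})) (mono F p t (γ, {k}))
      have e2 : Pi.single i (α i) + (γ - Pi.single i 1) = α := by
        ext l
        by_cases h : l = i
        · subst h; simp [hγi]
        · simp [γ, h]
      rw [lie_power_vector (Ne.symm hik) (by rw [hγi]; exact one_ne_zero) (hα i) hγ
        (by rw [hγi]; simpa using hα i), h1, h2, lie_zero, lie_zero, sub_zero, map_smul, e2,
        hγi] at h3
      simpa using h3

end Normalized

end Normalized

end

/-! ### Powers of derivations, and normalized derivations on polyvectors -/

section

/-- In characteristic `p`, the `p^v`-th power of a derivation is a derivation. -/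
def powDerivation (p : ℕ) [Fact p.Prime] [CharP F p] {L : Type*} [LieRing L] [LieAlgebra F L]
    (D : LieDerivation F L L) (v : ℕ) : LieDerivation F L L where
  toLinearMap := (D : L →ₗ[F] L) ^ p ^ v
  leibniz' x y := by
    have hpow : ∀ z, ((D : L →ₗ[F] L) ^ p ^ v) z = D^[p ^ v] z := fun z => by
      rw [Module.End.pow_apply]; rfl
    have hq : 0 < p ^ v := pow_pos_of_prime p v
    rw [hpow, hpow, hpow, ← lie_skew y, sub_neg_eq_add, D.iterate_apply_lie', Finset.sum_range_succ,
      Finset.sum_eq_single_of_mem 0 (Finset.mem_range.2 hq)]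
    · simp
    -- In the iterated Leibniz rule the binomials p^v choose i with 0 < i < p^v vanish mod p,
    -- leaving the two extreme terms.
    · intro i hi hi0
      have h1 : (((p ^ v).choose i : ℕ) : F) = 0 :=
        (CharP.cast_eq_zero_iff F p _).2
          ((Fact.out : p.Prime).dvd_choose_pow hi0 (Finset.mem_range.1 hi).ne)
      rw [← Nat.cast_smul_eq_nsmul F, h1, zero_smul]

variable {p : ℕ} [Fact p.Prime] [CharP F p] {t : Fin n → ℕ}

namespace Normalized

variable {D : LieDerivation F (evenHO F p t) (evenHO F p t)}

/-- The weights allow only a multiple of ξ^s₀ as the value on ξ^s₀. Brackets with the killed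
elements x_j ξ_i exchange one index at a time and so carry the vanishing from s₀ to every s. -/
theorem trivector_eq_zero (hD : Normalized D) (ht : ∀ i, 1 ≤ t i)
    (hvec : ∀ (α : Fin n → ℕ) k, (∀ i, α i < p ^ t i) → D (mono F p t (α, {k})) = 0)
    {s₀ : Finset (Fin n)} (hs₀ : s₀.card = 3)
    (h0 : symbol (D (mono F p t (0, s₀))) (0, s₀) = 0) (s : Finset (Fin n)) (hs : s.card = 3) :
    D (mono F p t (0, s)) = 0 := by
  induction hm : (s₀ \ s).card generalizing s with
  | zero =>
    have : s₀ = s := Finset.eq_of_subset_of_card_le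
      (Finset.sdiff_eq_empty_iff_subset.1 (Finset.card_eq_zero.1 hm)) (by omega)
    subst this
    have hadm : Admissible p t (0, s₀) := admissible_const (by rw [hs₀]; decide)
    rw [eq_zero_iff_symbol]
    intro a
    by_contra ha
    have h1 := hD.const_of_lower hadm (fun i hi => absurd rfl hi) ha
    have h2 := hD.weight_of_lower ht hadm (fun i hi => absurd rfl hi) ha
    have h3 : a.2 = s₀ := by
      ext i
      have := h2 i
      rw [weight_const] at this
      split_ifs at this <;> simp_all
    rw [show a = (0, s₀) from Prod.ext h1 h3] at ha
    exact ha h0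
  | succ m ih =>
    obtain ⟨j, hj⟩ : (s₀ \ s).Nonempty := Finset.card_pos.1 (by omega)
    rw [Finset.mem_sdiff] at hj
    obtain ⟨i, hi⟩ : (s \ s₀).Nonempty := by
      rw [Finset.sdiff_nonempty]
      intro h
      exact hj.2 (Finset.eq_of_subset_of_card_le h (by omega) ▸ hj.1)
    rw [Finset.mem_sdiff] at hi
    have hij : i ≠ j := fun h => hj.2 (h ▸ hi.1)
    set s' := insert j (s.erase i) with hs'
    have hje : j ∉ s.erase i := fun h => hj.2 (Finset.mem_erase.1 h).2
    have hcard : s'.card = 3 := by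
      rw [hs', Finset.card_insert_of_notMem hje, Finset.card_erase_add_one hi.1, hs]
    have hsd : s₀ \ s' = (s₀ \ s).erase j := by
      ext l
      simp only [hs', Finset.mem_sdiff, Finset.mem_insert, Finset.mem_erase]
      by_cases hl : l = i
      · subst hl; simp [hi.2]
      · simp [hl]; tauto
    have h1 : D (mono F p t (0, s')) = 0 := by
      refine ih s' hcard ?_
      rw [hsd, Finset.card_erase_of_mem (Finset.mem_sdiff.2 hj), hm]
      rfl
    have his' : i ∉ s' := by simp [hs', hij]
    have hback : insert i (s'.erase j) = s := by
      rw [hs', Finset.erase_insert hje, Finset.insert_erase hi.1]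
    obtain ⟨c, hc, h⟩ := lie_exchange (F := F) (p := p) (t := t) (ht j) (s := s') (i := j) (j := i)
      (by rw [hcard]; decide) (Finset.mem_insert_self _ _) his'
    rw [hback] at h
    have h2 := D.apply_lie_eq_sub (mono F p t (Pi.single j 1, {i})) (mono F p t (0, s'))
    rw [h, h1, hvec _ i (admissible_single (u := {i}) (one_lt_pow_of_prime (ht j)) (by simp)).1,
      lie_zero, lie_zero, sub_zero, map_smul] at h2
    exact (smul_eq_zero.1 h2).resolve_left hc

/-- For k ∈ u, x^(α) ξ^u is up to a nonzero scalar the bracket of x^(α) x_k^(1) raised to exponent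
α_k + 1, times ξ^(u \ {a, b}), with the trivector ξ_k ξ_a ξ_b. This lowers |u| by two while raising
the degree in x, so the outer induction is on |u| and covers all α. -/
theorem polyvector_eq_zero (hD : Normalized D) (hp : 2 < p) (ht : ∀ i, 1 ≤ t i)
    (hvec : ∀ (α : Fin n → ℕ) k, (∀ i, α i < p ^ t i) → D (mono F p t (α, {k})) = 0)
    (htri : ∀ s : Finset (Fin n), s.card = 3 → D (mono F p t (0, s)) = 0)
    (m : ℕ) : ∀ (N : ℕ) (α : Fin n → ℕ) (u : Finset (Fin n)), u.card = 2 * m + 1 →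
      (∀ i, α i < p ^ t i) → ∑ i, α i = N → D (mono F p t (α, u)) = 0 := by
  induction m with
  | zero =>
    intro N α u hu hα _
    obtain ⟨k, rfl⟩ := Finset.card_eq_one.1 hu
    exact hvec α k hα
  | succ m ihm =>
    intro N
    induction N using Nat.strong_induction_on with
    | _ N ihN =>
    intro α u hu hα hN
    have hadm : Admissible p t (α, u) := ⟨hα, ⟨m + 1, hu⟩⟩
    have hl : ∀ i, α i ≠ 0 → D (mono F p t (α - Pi.single i 1, u)) = 0 := fun i hi =>
      ihN _ (by have := sum_sub_single α i hi; omega) _ u hu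
        (fun j => lt_of_le_of_lt (Nat.sub_le _ _) (hα j)) rfl
    rw [eq_zero_iff_symbol]
    intro w
    by_contra hw
    obtain ⟨k, hk⟩ : u.Nonempty := Finset.card_pos.1 (by omega)
    -- At the top exponent x_k cannot be raised. There α_k = -1 in F, so the weight at k is 2, which
    -- is neither 0 nor 1; a nonzero value is then impossible. The inner induction on N supplies the
    -- lower monomials needed for this.
    have hαk : α k + 1 < p ^ t k := by
      by_contra h
      have h1 : α k + 1 = p ^ t k := by have := hα k; omega
      have h2 := congrArg (Nat.cast : ℕ → F) h1
      have h3 := ht k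
      push_cast at h2
      rw [CharP.cast_eq_zero F p, zero_pow (by omega)] at h2
      have h4 := hD.weight_of_lower ht hadm hl hw k
      simp only [weight, if_pos hk] at h4
      split_ifs at h4
      · exact one_ne_zero (α := F) (by linear_combination h2 + h4)
      · exact neg_one_ne (F := F) hp True (by simp; linear_combination -h2 - h4)
    obtain ⟨a, ha, b, hb, hab⟩ := Finset.one_lt_card.1
      (show 1 < (u.erase k).card by rw [Finset.card_erase_of_mem hk]; omega)
    have hu' : (u \ {a, b}) ∪ {a, b} = u := Finset.sdiff_union_of_subset (by
      intro x hx
      rcases Finset.mem_insert.1 hx with rfl | hx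
      · exact Finset.mem_of_mem_erase ha
      · rw [Finset.mem_singleton.1 hx]; exact Finset.mem_of_mem_erase hb)
    have hcard : (u \ {a, b}).card = 2 * m + 1 := by
      have := Finset.card_union_of_disjoint (Finset.sdiff_disjoint (s := {a, b}) (t := u))
      rw [hu', Finset.card_pair hab] at this
      omega
    have hka : k ≠ a := (Finset.ne_of_mem_erase ha).symm
    have hkb : k ≠ b := (Finset.ne_of_mem_erase hb).symm
    obtain ⟨c, hc, h⟩ := lie_trivector (F := F) (p := p) (t := t) (v := u \ {a, b}) (k := k)
      (a := a) (b := b) (α := α) ⟨m, hcard⟩ (by simp [hk, hka, hkb]) (by simp) (by simp) hab hα hαk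
    have h1 : D (mono F p t (α + Pi.single k 1, u \ {a, b})) = 0 := by
      refine ihm _ _ _ hcard (fun j => ?_) rfl
      by_cases hj : j = k
      · subst hj; simpa using hαk
      · simpa [hj] using hα j
    have h2 : D (mono F p t (0, {k, a, b})) = 0 :=
      htri _ (Finset.card_eq_three.2 ⟨k, a, b, hka, hkb, hab, rfl⟩)
    have h3 := D.apply_lie_eq_sub (mono F p t (α + Pi.single k 1, u \ {a, b}))
      (mono F p t (0, {k, a, b}))
    rw [h, hu', h1, h2, lie_zero, lie_zero, sub_zero, map_smul] at h3
    rw [(smul_eq_zero.1 h3).resolve_left hc, symbol_zero, Finsupp.zero_apply] at hw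
    exact hw rfl

/-- A normalized derivation is determined by its values on the `x_i^(p^v) ξ_i` and on one
trivector. -/
theorem eq_zero (hD : Normalized D) (hp : 2 < p) (ht : ∀ i, 1 ≤ t i) (hn : 2 ≤ n)
    (hpow : ∀ i v, 1 ≤ v → v < t i → symbol (D (mono F p t (Pi.single i (p ^ v), {i})))
      (0, {i}) = 0)
    {s₀ : Finset (Fin n)} (hs₀ : s₀.card = 3)
    (h0 : symbol (D (mono F p t (0, s₀))) (0, s₀) = 0) : D = 0 := by
  have hvec : ∀ (α : Fin n → ℕ) k, (∀ i, α i < p ^ t i) → D (mono F p t (α, {k})) = 0 :=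
    fun α k hα => hD.vector_eq_zero hp ht hn hpow _ α k hα (Nat.lt_succ_self _)
  have h := linearMap_eq_zero (D : evenHO F p t →ₗ[F] evenHO F p t) fun a ha => by
    obtain ⟨m, hm⟩ := ha.2
    exact hD.polyvector_eq_zero hp ht hvec (hD.trivector_eq_zero ht hvec hs₀ h0) m _ a.1 a.2 hm
      ha.1 rfl
  ext1 x
  exact LinearMap.congr_fun h x

end Normalized

/-! ### Representatives of the outer derivations and their coordinates -/

section Outer

theorem powDerivation_apply {L : Type*} [LieRing L] [LieAlgebra F L] (D : LieDerivation F L L)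
    (v : ℕ) (x : L) : powDerivation p D v x = D^[p ^ v] x := by
  change ((D : L →ₗ[F] L) ^ p ^ v) x = _
  rw [Module.End.pow_apply]
  rfl

variable (F p t) in
/-- The derivation `∂_i^(p^v)` of `𝓗𝓞`. -/
def partialPower (i : Fin n) (v : ℕ) : LieDerivation F (evenHO F p t) (evenHO F p t) :=
  powDerivation p (LieDerivation.ad F (evenHO F p t) (-mono F p t (0, {i}))) v

theorem symbol_partialPower (i : Fin n) (v : ℕ) (x : evenHO F p t) (a : Mon n) :
    symbol (partialPower F p t i v x) a = symbol x (a.1 + Pi.single i (p ^ v), a.2) := by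
  rw [partialPower, powDerivation_apply]
  generalize p ^ v = q
  induction q generalizing a with
  | zero => simp
  | succ q ih =>
    rw [Function.iterate_succ_apply', ad_apply_eq_lie, neg_lie, symbol_neg, Finsupp.neg_apply,
      lie_xi_apply, neg_neg, ih]
    simp only [add_assoc, ← Pi.single_add, add_comm 1 q]

/-- The index set of a basis of the outer derivations. -/
abbrev OuterIndex (t : Fin n → ℕ) : Type := Option (Σ i : Fin n, Fin (t i - 1))

variable (F p t) in
/-- Derivations that represent a basis of the outer derivations. -/
def outerDerivation : OuterIndex t → LieDerivation F (evenHO F p t) (evenHO F p t)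
  | none => degreeDerivation F p t
  -- The shift makes v run through 1 ≤ v < t_i: for v = 0 the derivation ∂_i is inner, and for v =
  -- t_i the power is zero by truncation.
  | some j => partialPower F p t j.1 (j.2 + 1)

/-- On coefficients the ∂_i^(p^v) are translations of α and the degree derivation is multiplication
by a function of u alone. -/
theorem outerDerivation_comm (j k : OuterIndex t) (x : evenHO F p t) :
    outerDerivation F p t j (outerDerivation F p t k x) =
      outerDerivation F p t k (outerDerivation F p t j x) := by
  refine symbol_ext fun a _ => ?_
  cases j <;> cases k <;>
    simp only [outerDerivation, symbol_partialPower, symbol_degreeDerivation]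
  rw [add_right_comm]

theorem symbol_mono_apply {a : Mon n} (ha : Admissible p t a) (b : Mon n) :
    symbol (mono F p t a) b = if a = b then 1 else 0 := by
  rw [symbol_mono ha]
  split_ifs with h
  · rw [h, Finsupp.single_eq_same]
  · exact Finsupp.single_eq_of_ne' h

/-- The factor |u| - 1 vanishes on vectors, and lowering an exponent by p^v ≥ p kills monomials
whose exponents are at most 1. -/
theorem outerDerivation_normalized (j : OuterIndex t) :
    Normalized (outerDerivation F p t j) := by
  refine ⟨fun i => ?_, fun i => ?_⟩ <;> refine symbol_ext fun a _ => ?_ <;>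
    rw [symbol_zero, Finsupp.zero_apply] <;> cases j with
  | none =>
    rw [outerDerivation, symbol_degreeDerivation]
    by_cases h : a.2.card = 1
    · simp [h]
    · rw [symbol_mono_apply_of_ne, mul_zero]
      rintro rfl
      simp at h
  | some j =>
    rw [outerDerivation, symbol_partialPower]
    refine symbol_mono_apply_of_ne fun h => ?_
    have h1 := congrFun (congrArg Prod.fst h) j.1
    have h2 : 1 < p ^ ((j.2 : ℕ) + 1) := one_lt_pow_of_prime (by omega)
    by_cases hij : j.1 = i
    · rw [← hij] at h1
      simp at h1
      omega
    · simp [hij] at h1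
      omega

/-- The value at `x`, as a linear function of the derivation. -/
def evalLinear {L : Type*} [LieRing L] [LieAlgebra F L] (x : L) : LieDerivation F L L →ₗ[F] L where
  toFun D := D x
  map_add' _ _ := rfl
  map_smul' _ _ := rfl

variable (F p t) in
/-- The coefficient of the monomial `a`, as a linear functional on `𝓗𝓞`. -/
def coefficient (a : Mon n) : evenHO F p t →ₗ[F] F where
  toFun x := symbol x a
  map_add' _ _ := by simp
  map_smul' _ _ := by simp

variable (F p t) in
/-- The coordinates of a normalized derivation. -/
def outerCoordinate (s₀ : Finset (Fin n)) :
    LieDerivation F (evenHO F p t) (evenHO F p t) →ₗ[F] OuterIndex t → F :=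
  LinearMap.pi fun j => match j with
    -- The degree derivation multiplies a trivector by 3 - 1 = 2, whence the normalizing factor.
    | none => (2 : F)⁻¹ • coefficient F p t (0, s₀) ∘ₗ evalLinear (mono F p t (0, s₀))
    | some j => coefficient F p t (0, {j.1}) ∘ₗ
        evalLinear (mono F p t (Pi.single j.1 (p ^ ((j.2 : ℕ) + 1)), {j.1}))

theorem outerCoordinate_none (s₀ : Finset (Fin n))
    (D : LieDerivation F (evenHO F p t) (evenHO F p t)) :
    outerCoordinate F p t s₀ D none = (2 : F)⁻¹ * symbol (D (mono F p t (0, s₀))) (0, s₀) := rfl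

theorem outerCoordinate_some (s₀ : Finset (Fin n))
    (D : LieDerivation F (evenHO F p t) (evenHO F p t)) (j : Σ i : Fin n, Fin (t i - 1)) :
    outerCoordinate F p t s₀ D (some j) =
      symbol (D (mono F p t (Pi.single j.1 (p ^ ((j.2 : ℕ) + 1)), {j.1}))) (0, {j.1}) := rfl

theorem outerCoordinate_outerDerivation (hp : 2 < p) {s₀ : Finset (Fin n)} (hs₀ : s₀.card = 3)
    (j k : OuterIndex t) :
    outerCoordinate F p t s₀ (outerDerivation F p t j) k = if j = k then 1 else 0 := by
  have hadm : Admissible p t (0, s₀) := admissible_const (by rw [hs₀]; decide)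
  have hpp : p.Prime := Fact.out
  cases k with
  | none =>
    rw [outerCoordinate_none]
    cases j with
    | none =>
      have h2 : (2 : F) ≠ 0 := by
        have := neg_one_ne (F := F) hp True
        intro h
        exact this (by simp; linear_combination -h)
      rw [outerDerivation, symbol_degreeDerivation, symbol_mono_apply hadm]
      simp only [if_true, hs₀]
      push_cast
      field_simp
      norm_num
    | some j =>
      rw [outerDerivation, symbol_partialPower, symbol_mono_apply_of_ne, mul_zero]
      · simp
      · intro h
        have h1 := congrFun (congrArg Prod.fst h) j.1
        simp only [Pi.zero_apply, Pi.add_apply, Pi.single_eq_same, zero_add] at h1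
        exact (pow_pos_of_prime p _).ne h1
  | some k =>
    have hk : Admissible p t (Pi.single k.1 (p ^ ((k.2 : ℕ) + 1)), {k.1}) := by
      refine admissible_single (Nat.pow_lt_pow_right hpp.one_lt ?_) (by simp)
      have := k.2.2
      omega
    rw [outerCoordinate_some]
    cases j with
    | none =>
      rw [outerDerivation, symbol_degreeDerivation]
      simp
    | some j =>
      rw [outerDerivation, symbol_partialPower, symbol_mono_apply hk]
      simp only [zero_add, Option.some.injEq]
      congr 1
      rw [eq_iff_iff]
      constructor
      · intro h
        obtain ⟨j1, j2⟩ := j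
        obtain ⟨k1, k2⟩ := k
        have h2 := congrFun (congrArg Prod.fst h) k1
        have h1 : j1 = k1 := by
          by_contra hne
          simp only [Pi.single_eq_same, Pi.single_eq_of_ne (Ne.symm hne)] at h2
          exact (pow_pos_of_prime p _).ne' h2
        subst h1
        simp only [Pi.single_eq_same] at h2
        have h3 := Nat.pow_right_injective hpp.two_le h2
        simp only [Nat.add_right_cancel_iff] at h3
        rw [Fin.ext h3]
      · rintro rfl
        rfl

variable (F p t) in
/-- The span of the outer derivations. -/
def outerCombination :
    (OuterIndex t → F) →ₗ[F] LieDerivation F (evenHO F p t) (evenHO F p t) :=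
  Fintype.linearCombination F (outerDerivation F p t)

theorem outerCombination_apply (c : OuterIndex t → F) (x : evenHO F p t) :
    outerCombination F p t c x = ∑ j, c j • outerDerivation F p t j x := by
  change evalLinear x (outerCombination F p t c) = _
  rw [outerCombination, Fintype.linearCombination_apply, map_sum]
  rfl

theorem outerCombination_normalized (c : OuterIndex t → F) :
    Normalized (outerCombination F p t c) := by
  constructor <;> intro i <;> rw [outerCombination_apply] <;>
    refine Finset.sum_eq_zero fun j _ => ?_
  · rw [(outerDerivation_normalized j).xi, smul_zero]
  · rw [(outerDerivation_normalized j).torus, smul_zero]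

theorem outerCombination_comm (c d : OuterIndex t → F) :
    ⁅outerCombination F p t c, outerCombination F p t d⁆ = 0 := by
  ext1 x
  rw [LieDerivation.commutator_apply, outerCombination_apply, outerCombination_apply,
    outerCombination_apply c x, LieDerivation.zero_apply, sub_eq_zero]
  simp only [outerCombination_apply, map_sum, map_smul, Finset.smul_sum]
  refine Finset.sum_congr rfl fun j _ => Finset.sum_congr rfl fun k _ => ?_
  rw [outerDerivation_comm j k]

theorem outerCoordinate_outerCombination (hp : 2 < p) {s₀ : Finset (Fin n)} (hs₀ : s₀.card = 3)
    (c : OuterIndex t → F) : outerCoordinate F p t s₀ (outerCombination F p t c) = c := by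
  ext k
  rw [outerCombination, Fintype.linearCombination_apply, map_sum, Finset.sum_apply]
  simp only [map_smul, Pi.smul_apply, outerCoordinate_outerDerivation hp hs₀, smul_eq_mul]
  simp

/-! ### The quotient by inner derivations -/

/-- After normalization, subtracting the combination with the same coordinates leaves a normalized
derivation with zero coordinates, which vanishes by `Normalized.eq_zero`. -/
theorem exists_eq_ad_add_outerCombination (hp : 2 < p) (hn : 3 ≤ n) (ht : ∀ i, 1 ≤ t i)
    (D : LieDerivation F (evenHO F p t) (evenHO F p t)) :
    ∃ b c, D = LieDerivation.ad F (evenHO F p t) b + outerCombination F p t c := by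
  obtain ⟨s₀, -, hs₀⟩ := Finset.exists_subset_card_eq (s := (Finset.univ : Finset (Fin n)))
    (n := 3) (by simpa using hn)
  obtain ⟨b, hb⟩ := exists_normalized_sub_ad ht D
  set D' := D - LieDerivation.ad F (evenHO F p t) b with hD'
  set c := outerCoordinate F p t s₀ D' with hc
  have hN := outerCombination_normalized (F := F) (p := p) c
  have hD'' : Normalized (D' - outerCombination F p t c) :=
    ⟨fun i => by rw [LieDerivation.sub_apply, hb.xi, hN.xi, sub_zero],
      fun i => by rw [LieDerivation.sub_apply, hb.torus, hN.torus, sub_zero]⟩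
  have hz : outerCoordinate F p t s₀ (D' - outerCombination F p t c) = 0 := by
    rw [map_sub, outerCoordinate_outerCombination hp hs₀, hc, sub_self]
  have h2 : (2 : F)⁻¹ ≠ 0 := by
    have := neg_one_ne (F := F) hp True
    refine inv_ne_zero fun h => this (by simp; linear_combination -h)
  have := hD''.eq_zero hp ht (by omega) (fun i v hv hvt => ?_) hs₀ ?_
  · refine ⟨b, c, ?_⟩
    rw [sub_eq_zero, hD', sub_eq_iff_eq_add] at this
    rw [this, add_comm]
  · have h1 := congrFun hz (some ⟨i, ⟨v - 1, by omega⟩⟩)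
    rw [outerCoordinate_some] at h1
    simpa [Nat.sub_add_cancel hv] using h1
  · have h1 := congrFun hz none
    rw [outerCoordinate_none] at h1
    exact (mul_eq_zero.1 h1).resolve_left h2

/-- Commuting with all ξ_i makes b free of x. Each remaining ξ^u has weight 1 under x_k ξ_k for k ∈
u, so commuting with the torus kills it. This gives linear independence modulo inner derivations. -/
theorem eq_zero_of_ad_normalized (ht : ∀ i, 1 ≤ t i) {b : evenHO F p t}
    (hb : Normalized (LieDerivation.ad F (evenHO F p t) b)) : b = 0 := by
  refine symbol_ext fun a ha => ?_
  rw [symbol_zero, Finsupp.zero_apply]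
  by_cases h0 : a.1 = 0
  · obtain ⟨k, hk⟩ : a.2.Nonempty := Finset.card_pos.1 ha.2.pos
    have h1 := hb.torus k
    rw [ad_apply_eq_lie, ← lie_skew, neg_eq_zero] at h1
    have h2 := congrArg (fun x => symbol x a) h1
    simpa [lie_torus_apply (ht k), weight, hk, h0] using h2
  · refine symbol_apply_of_lie_xi_eq_zero (fun i => ?_) h0
    have h1 := hb.xi i
    rwa [ad_apply_eq_lie, ← lie_skew, neg_eq_zero] at h1

variable (F p t) in
/-- The classes of the outer derivations. -/
def outerClass : (OuterIndex t → F) →ₗ[F] OuterDer F (evenHO F p t) :=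
  ((LieDerivation.ad F (evenHO F p t)).idealRange.toSubmodule.mkQ) ∘ₗ outerCombination F p t

theorem outerClass_apply (c : OuterIndex t → F) : outerClass F p t c =
    LieSubmodule.Quotient.mk (outerCombination F p t c) := rfl

theorem outerClass_bijective (hp : 2 < p) (hn : 3 ≤ n) (ht : ∀ i, 1 ≤ t i) :
    Function.Bijective (outerClass F p t) := by
  constructor
  · rw [← LinearMap.ker_eq_bot, LinearMap.ker_eq_bot']
    intro c hc
    rw [outerClass_apply, LieSubmodule.Quotient.mk_eq_zero',
      LieDerivation.mem_ad_idealRange_iff] at hc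
    obtain ⟨b, hb⟩ := hc
    have hb0 := eq_zero_of_ad_normalized ht (hb ▸ outerCombination_normalized c)
    obtain ⟨s₀, -, hs₀⟩ := Finset.exists_subset_card_eq (s := (Finset.univ : Finset (Fin n)))
      (n := 3) (by simpa using hn)
    rw [← outerCoordinate_outerCombination hp hs₀ c, ← hb, hb0, map_zero, map_zero]
  · intro x
    obtain ⟨D, rfl⟩ := LieSubmodule.Quotient.surjective_mk' _ x
    obtain ⟨b, c, rfl⟩ := exists_eq_ad_add_outerCombination hp hn ht D
    refine ⟨c, ?_⟩
    rw [map_add, (LieSubmodule.Quotient.mk_eq_zero _).2, zero_add]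
    · rfl
    · exact LieDerivation.mem_ad_idealRange_iff.2 ⟨b, rfl⟩

end Outer

end

end

end OddHamiltonian

theorem mainTheorem5 {F : Type*} [Field F] (p : ℕ) [Fact p.Prime] [CharP F p] (hp : 3 < p)
    (n : ℕ) (hn : 3 ≤ n) (t : Fin n → ℕ) (ht : ∀ i, 1 ≤ t i) :
    IsLieAbelian (OddHamiltonian.OuterDer F (OddHamiltonian.evenHO F p t)) ∧
      Module.Finite F (OddHamiltonian.OuterDer F (OddHamiltonian.evenHO F p t)) ∧
      (Module.finrank F (OddHamiltonian.OuterDer F (OddHamiltonian.evenHO F p t)) : ℤ) =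
        ∑ i, (t i : ℤ) - n + 1 := by
  have hbij := OddHamiltonian.outerClass_bijective (F := F) (p := p) (by omega) hn ht
  let e := LinearEquiv.ofBijective (OddHamiltonian.outerClass F p t) hbij
  refine ⟨⟨fun x y => ?_⟩, Module.Finite.equiv e, ?_⟩
  · obtain ⟨c, rfl⟩ := hbij.2 x
    obtain ⟨d, rfl⟩ := hbij.2 y
    rw [OddHamiltonian.outerClass_apply, OddHamiltonian.outerClass_apply,
      ← LieSubmodule.Quotient.mk_bracket, OddHamiltonian.outerCombination_comm]
    rfl
  · rw [← e.finrank_eq, Module.finrank_fintype_fun_eq_card, Fintype.card_option,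
      Fintype.card_sigma]
    simp only [Fintype.card_fin]
    push_cast
    -- The summands t_i - 1 are truncated differences in ℕ; t_i ≥ 1 makes them true differences in
    -- ℤ.
    rw [Finset.sum_congr rfl fun i _ => Nat.cast_pred (R := ℤ) (ht i)]
    simp
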